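/- Let $R$ be an associative ring with identity, let $N$ be an $R$-$R$-bimodule, put $N^{\otimes 0}=R$ and $N^{\otimes (i+1)}=N\otimes_R N^{\otimes i}$, and let $T=T_R(N)=\bigoplus_{i\ge 0}N^{\otimes i}$ be the tensor ring. Modules are left modules; write $l=T\otimes_R-$ for the induction functor from $R$-modules to $T$-modules. Let $m\ge 0$ and assume that $N$ is $m$-nilpotent, that is, $N^{\otimes (m+1)}=0$. Let $P_1\xrightarrow{\sigma}P_0\to Y\to 0$ be a projective presentation of an $R$-module $Y$. For modules over any ring, let $\mathcal D_\sigma$ be the class of modules $L$ such that $\operatorname{Hom}(\sigma,L)\colon \operatorname{Hom}(P_0,L)\to\operatorname{Hom}(P_1,L)$ is surjective; $\operatorname{Gen}(X)$ the class of quotients of direct sums of copies of $X$; $\operatorname{Add}(X)$ the class of direct summands of direct sums of copies of $X$; and $X^{\perp_n}$ the class of modules $L$ with $\operatorname{Ext}^j(X,L)=0$ for $1\le j\le n$. A module $X$ with a projective presentation $P_1\xrightarrow{\sigma}P_0\to X\to 0$ is *partial silting* with respect to $\sigma$ if $X\in\mathcal D_\sigma$ and $\mathcal D_\sigma$ is a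 torsion class (closed under quotients, extensions and direct sums), and *silting* with respect to $\sigma$ if $\operatorname{Gen}(X)=\mathcal D_\sigma$. For $n\ge 0$, $X$ is *partial $n$-tilting* if $\operatorname{pd}X\le n$ and $\operatorname{Ext}^j(X,X)=0$ for all $j\ge 1$; it is *$n$-tilting* if moreover for every projective module $P$ there is an exact sequence $0\to P\to X_0\to\cdots\to X_n\to 0$ with all $X_j\in\operatorname{Add}(X)$. Then the following hold. 1. $l(Y)$ is a silting $T$-module with respect to $l(\sigma)$ if and only if $Y$ is silting with respect to $\sigma$ and $N^{\otimes i}\otimes_R Y\in\operatorname{Gen}(Y)$ for all $1\le i\le m$. Likewise, $l(Y)$ is a partial silting $T$-module with respect to $l(\sigma)$ if and only if $Y$ is partial silting with respect to $\sigma$ and $N^{\otimes i}\otimes_R Y\in\mathcal D_\sigma$ for all $1\le i\le m$. 2. Let $n\ge 0$, and suppose that $\operatorname{Tor}^R_t(N^{\otimes i},Y)=0$ for all $1\le i\le m$ and all $1\le t\le n+1$. Then $l(Y)$ is $n$-tilting if and only if $Y$ is $n$-tilting and $N^{\otimes i}\otimes_R Y\in Y^{\perp_n}$ for all $1\le i\le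 m$. Likewise, $l(Y)$ is partial $n$-tilting if and only if $Y$ is partial $n$-tilting and $N^{\otimes i}\otimes_R Y\in Y^{\perp_n}$ for all $1\le i\le m$. -/

import Mathlib

open CategoryTheory CategoryTheory.Limits
open scoped TensorProduct DirectSum

universe v u

namespace SiltingTensor

/-! ### Silting and tilting objects in abelian categories -/

section Abelian

variable {C : Type u} [Category.{v} C] [Abelian C]

/-- `P₁ --σ--> P₀ ⟶ X ⟶ 0` is a projective presentation of `X` for some morphism `P₀ ⟶ X`. -/
def IsProjectivePresentation {P₁ P₀ : C} (σ : P₁ ⟶ P₀) (X : C) : Prop :=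
  Projective P₁ ∧ Projective P₀ ∧
    ∃ (π : P₀ ⟶ X) (w : σ ≫ π = 0), (ShortComplex.mk σ π w).Exact ∧ Epi π

/-- The class `𝒟_σ` of the objects `L` for which `Hom(σ, L) : Hom(P₀, L) → Hom(P₁, L)` is
surjective. -/
def classD {P₁ P₀ : C} (σ : P₁ ⟶ P₀) : ObjectProperty C := fun L =>
  Function.Surjective (fun g : P₀ ⟶ L => σ ≫ g)

/-- A torsion class: closed under isomorphisms, quotients, extensions and (set-indexed)
coproducts. -/
structure IsTorsionClass (D : ObjectProperty C) : Prop where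
  closedIso : D.IsClosedUnderIsomorphisms
  closedQuotients : D.IsClosedUnderQuotients
  closedExtensions : D.IsClosedUnderExtensions
  closedCoproducts : ∀ I : Type v, D.IsClosedUnderColimitsOfShape (Discrete I)

/-- `Gen X`: the quotients of coproducts of copies of `X`. -/
def Gen [HasCoproducts.{v} C] (X : C) : ObjectProperty C := fun L =>
  ∃ (I : Type v) (p : (∐ fun _ : I => X) ⟶ L), Epi p

/-- `Add X`: the direct summands of coproducts of copies of `X`. -/
def addClosure [HasCoproducts.{v} C] (X : C) : ObjectProperty C := fun L =>
  ∃ I : Type v, Nonempty (Retract L (∐ fun _ : I => X))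

/-- `X` is partial silting with respect to the projective presentation `σ`. -/
structure IsPartialSilting {P₁ P₀ : C} (σ : P₁ ⟶ P₀) (X : C) : Prop where
  presentation : IsProjectivePresentation σ X
  mem : classD σ X
  torsion : IsTorsionClass (classD σ)

/-- `X` is silting with respect to the projective presentation `σ`. -/
structure IsSilting [HasCoproducts.{v} C] {P₁ P₀ : C} (σ : P₁ ⟶ P₀) (X : C) : Prop where
  presentation : IsProjectivePresentation σ X
  gen_eq : Gen X = classD σ

/-- `X^{⊥_n}`: the objects `L` with `Ext^j(X, L) = 0` for all `1 ≤ j ≤ n`. -/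
def perpN [HasExt.{v} C] (n : ℕ) (X : C) : ObjectProperty C := fun L =>
  ∀ j : ℕ, 1 ≤ j → j ≤ n → Subsingleton (Abelian.Ext.{v} X L j)

/-- `X` is partial `n`-tilting: `pd X ≤ n`, and `Ext^j(X, X) = 0` for all `j ≥ 1`. -/
structure IsPartialTilting [HasExt.{v} C] (n : ℕ) (X : C) : Prop where
  pd_le : HasProjectiveDimensionLE X n
  ext_self : ∀ j : ℕ, 1 ≤ j → Subsingleton (Abelian.Ext.{v} X X j)

/-- There is an exact sequence `0 ⟶ P ⟶ X₀ ⟶ ⋯ ⟶ Xₙ ⟶ 0` with all `Xⱼ` in `Add X`. It is written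
as an acyclic cochain complex `K` with `P` in degree `0`, with `Xⱼ` in degree `j + 1`, and with zero
objects in the degrees above `n + 1`. -/
def HasAddCoresolution [HasCoproducts.{v} C] (n : ℕ) (X P : C) : Prop :=
  ∃ K : CochainComplex C ℕ, K.Acyclic ∧ Nonempty (K.X 0 ≅ P) ∧
    (∀ j : ℕ, j ≤ n → addClosure X (K.X (j + 1))) ∧ (∀ j : ℕ, n + 1 < j → IsZero (K.X j))

/-- `X` is `n`-tilting. -/
structure IsTilting [HasCoproducts.{v} C] [HasExt.{v} C] (n : ℕ) (X : C) : Prop extends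
    IsPartialTilting n X where
  coresolution : ∀ P : C, Projective P → HasAddCoresolution n X P

end Abelian

/-! ### The tensor product over a noncommutative ring

A right `R`-module is a module over `Rᵐᵒᵖ`. -/

section Balanced

variable (R : Type u) [Ring R]
variable (M : Type u) [AddCommGroup M] [Module Rᵐᵒᵖ M]
variable (Y : Type u) [AddCommGroup Y] [Module R Y]

/-- The relations `m r ⊗ y = m ⊗ r y`. -/
def balancedRel : AddSubgroup (M ⊗[ℤ] Y) :=
  AddSubgroup.closure {z | ∃ (m : M) (r : R) (y : Y),
    z = (MulOpposite.op r • m) ⊗ₜ[ℤ] y - m ⊗ₜ[ℤ] (r • y)}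

/-- The abelian group `M ⊗_R Y`, for a right `R`-module `M` and a left `R`-module `Y`. -/
def BTensor : Type u := (M ⊗[ℤ] Y) ⧸ balancedRel R M Y

instance : AddCommGroup (BTensor R M Y) :=
  inferInstanceAs (AddCommGroup ((M ⊗[ℤ] Y) ⧸ balancedRel R M Y))

variable {M Y}

/-- The pure tensor `m ⊗ y`. -/
def tmul (m : M) (y : Y) : BTensor R M Y := QuotientAddGroup.mk (m ⊗ₜ[ℤ] y)

variable {R}

theorem tmul_add (m : M) (y y' : Y) : tmul R m (y + y') = tmul R m y + tmul R m y' := by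
  unfold tmul; rw [TensorProduct.tmul_add]; rfl

theorem add_tmul (m m' : M) (y : Y) : tmul R (m + m') y = tmul R m y + tmul R m' y := by
  unfold tmul; rw [TensorProduct.add_tmul]; rfl

theorem zero_tmul (y : Y) : tmul R (0 : M) y = 0 := by
  unfold tmul; rw [TensorProduct.zero_tmul]; rfl

theorem tmul_zero (m : M) : tmul R m (0 : Y) = 0 := by
  unfold tmul; rw [TensorProduct.tmul_zero]; rfl

theorem tmul_balanced (m : M) (r : R) (y : Y) :
    tmul R (MulOpposite.op r • m) y = tmul R m (r • y) := by
  refine (QuotientAddGroup.eq_iff_sub_mem).2 ?_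
  exact AddSubgroup.subset_closure ⟨m, r, y, rfl⟩

theorem BTensor.induction {p : BTensor R M Y → Prop} (z : BTensor R M Y)
    (ht : ∀ m y, p (tmul R m y)) (ha : ∀ a b, p a → p b → p (a + b)) : p z := by
  induction z using QuotientAddGroup.induction_on with
  | H z =>
    induction z using TensorProduct.induction_on with
    | zero => have := ht 0 0; unfold tmul at this; rwa [TensorProduct.tmul_zero] at this
    | tmul m y => exact ht m y
    | add a b iha ihb => exact ha _ _ iha ihb

/-- The universal property of `M ⊗_R Y`. -/
def BTensor.lift {A : Type*} [AddCommGroup A] (f : M →+ Y →+ A)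
    (hf : ∀ (m : M) (r : R) (y : Y), f (MulOpposite.op r • m) y = f m (r • y)) :
    BTensor R M Y →+ A :=
  QuotientAddGroup.lift (balancedRel R M Y)
    (TensorProduct.liftAddHom f (fun k m y => by simp))
    ((AddSubgroup.closure_le _).2 (by
      rintro _ ⟨m, r, y, rfl⟩
      simp [hf]))

@[simp] theorem BTensor.lift_tmul {A : Type*} [AddCommGroup A] (f : M →+ Y →+ A)
    (hf : ∀ (m : M) (r : R) (y : Y), f (MulOpposite.op r • m) y = f m (r • y)) (m : M) (y : Y) :
    BTensor.lift f hf (tmul R m y) = f m y := rfl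

theorem BTensor.hom_ext {A : Type*} [AddCommGroup A] {f g : BTensor R M Y →+ A}
    (h : ∀ m y, f (tmul R m y) = g (tmul R m y)) : f = g := by
  ext z
  induction z using BTensor.induction with
  | ht m y => exact h m y
  | ha a b iha ihb => rw [map_add, map_add, iha, ihb]

/-- The additive map `f ⊗ g`. -/
def BTensor.map {M' Y' : Type u} [AddCommGroup M'] [Module Rᵐᵒᵖ M'] [AddCommGroup Y']
    [Module R Y'] (f : M →ₗ[Rᵐᵒᵖ] M') (g : Y →ₗ[R] Y') : BTensor R M Y →+ BTensor R M' Y' :=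
  BTensor.lift
    (AddMonoidHom.mk' (fun m => AddMonoidHom.mk' (fun y => tmul R (f m) (g y))
      (fun y y' => by rw [map_add, tmul_add]))
      (fun m m' => by ext y; simp [add_tmul]))
    (fun m r y => by simp [tmul_balanced])

@[simp] theorem BTensor.map_tmul {M' Y' : Type u} [AddCommGroup M'] [Module Rᵐᵒᵖ M']
    [AddCommGroup Y'] [Module R Y'] (f : M →ₗ[Rᵐᵒᵖ] M') (g : Y →ₗ[R] Y') (m : M) (y : Y) :
    BTensor.map f g (tmul R m y) = tmul R (f m) (g y) := rfl

variable (R M Y)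

/-- If `M` is an `S`-`R`-bimodule, then `M ⊗_R Y` is a left `S`-module by `s (m ⊗ y) = s m ⊗ y`. -/
instance BTensor.leftModule (S : Type u) [Ring S] [Module S M] [SMulCommClass S Rᵐᵒᵖ M] :
    Module S (BTensor R M Y) :=
  Module.compHom (BTensor R M Y)
    ({ toFun := fun s => BTensor.map (Module.toModuleEnd Rᵐᵒᵖ (S := S) M s) LinearMap.id
       map_one' := BTensor.hom_ext (fun m y => congrArg (tmul R · y) (one_smul S m))
       map_mul' := fun s t => BTensor.hom_ext
        (fun m y => congrArg (tmul R · y) (mul_smul s t m))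
       map_zero' := BTensor.hom_ext
        (fun m y => (congrArg (tmul R · y) (zero_smul S m)).trans (zero_tmul y))
       map_add' := fun s t => BTensor.hom_ext
        (fun m y => (congrArg (tmul R · y) (add_smul s t m)).trans (add_tmul _ _ y)) } :
      S →+* AddMonoid.End (BTensor R M Y))

@[simp] theorem smul_tmul {S : Type u} [Ring S] [Module S M] [SMulCommClass S Rᵐᵒᵖ M]
    (s : S) (m : M) (y : Y) : s • tmul R m y = tmul R (s • m) y := rfl

/-- If `Y` is an `R`-`S`-bimodule, then `M ⊗_R Y` is a right `S`-module by
`(m ⊗ y) s = m ⊗ y s`. -/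
abbrev BTensor.rightModule (S : Type u) [Ring S] [Module Sᵐᵒᵖ Y] [SMulCommClass R Sᵐᵒᵖ Y] :
    Module Sᵐᵒᵖ (BTensor R M Y) :=
  haveI : SMulCommClass Sᵐᵒᵖ R Y := SMulCommClass.symm _ _ _
  Module.compHom (BTensor R M Y)
    ({ toFun := fun s => BTensor.map LinearMap.id (Module.toModuleEnd R (S := Sᵐᵒᵖ) Y s)
       map_one' := BTensor.hom_ext (fun m y => congrArg (tmul R m) (one_smul Sᵐᵒᵖ y))
       map_mul' := fun s t => BTensor.hom_ext
        (fun m y => congrArg (tmul R m) (mul_smul s t y))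
       map_zero' := BTensor.hom_ext
        (fun m y => (congrArg (tmul R m) (zero_smul Sᵐᵒᵖ y)).trans (tmul_zero m))
       map_add' := fun s t => BTensor.hom_ext
        (fun m y => (congrArg (tmul R m) (add_smul s t y)).trans (tmul_add m _ _)) } :
      Sᵐᵒᵖ →+* AddMonoid.End (BTensor R M Y))

end Balanced

/-! ### Tensor functors and Tor -/

section Functors

variable (R : Type u) [Ring R]

/-- For an `S`-`R`-bimodule `M`, the functor `M ⊗_R -` from left `R`-modules to left
`S`-modules. -/
def tensorFunctor (S : Type u) [Ring S] (M : Type u) [AddCommGroup M] [Module S M]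
    [Module Rᵐᵒᵖ M] [SMulCommClass S Rᵐᵒᵖ M] : ModuleCat.{u} R ⥤ ModuleCat.{u} S where
  obj Y := ModuleCat.of S (BTensor R M Y)
  map {Y Y'} f := ModuleCat.ofHom
    { BTensor.map (LinearMap.id : M →ₗ[Rᵐᵒᵖ] M) f.hom with
      map_smul' := fun s z => by
        induction z using BTensor.induction with
        | ht m y => rfl
        | ha a b iha ihb =>
          simp only [smul_add, ZeroHom.toFun_eq_coe, AddMonoidHom.toZeroHom_coe, map_add] at *
          rw [iha, ihb] }
  map_id Y := by
    ext z
    exact DFunLike.congr_fun (BTensor.hom_ext (f := BTensor.map LinearMap.id LinearMap.id)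
      (g := AddMonoidHom.id _) (fun m y => rfl)) z
  map_comp {Y Y' Y''} f g := by
    ext z
    exact DFunLike.congr_fun (BTensor.hom_ext (f := BTensor.map LinearMap.id (g.hom.comp f.hom))
      (g := (BTensor.map LinearMap.id g.hom).comp (BTensor.map LinearMap.id f.hom))
      (fun m y => rfl)) z

/-- For a right `R`-module `M`, the functor `M ⊗_R -` from left `R`-modules to abelian groups. -/
def tensorAb (M : Type u) [AddCommGroup M] [Module Rᵐᵒᵖ M] :
    ModuleCat.{u} R ⥤ AddCommGrpCat.{u} where
  obj Y := AddCommGrpCat.of (BTensor R M Y)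
  map {Y Y'} f := AddCommGrpCat.ofHom (BTensor.map (LinearMap.id : M →ₗ[Rᵐᵒᵖ] M) f.hom)
  map_id Y := by
    ext z
    exact DFunLike.congr_fun (BTensor.hom_ext (f := BTensor.map LinearMap.id LinearMap.id)
      (g := AddMonoidHom.id _) (fun m y => rfl)) z
  map_comp {Y Y' Y''} f g := by
    ext z
    exact DFunLike.congr_fun (BTensor.hom_ext (f := BTensor.map LinearMap.id (g.hom.comp f.hom))
      (g := (BTensor.map LinearMap.id g.hom).comp (BTensor.map LinearMap.id f.hom))
      (fun m y => rfl)) z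

instance (M : Type u) [AddCommGroup M] [Module Rᵐᵒᵖ M] : (tensorAb R M).Additive where
  map_add {Y Y' f g} := by
    ext z
    exact DFunLike.congr_fun (BTensor.hom_ext (f := BTensor.map LinearMap.id (f.hom + g.hom))
      (g := BTensor.map LinearMap.id f.hom + BTensor.map LinearMap.id g.hom)
      (fun m y => by
        rw [AddMonoidHom.add_apply, BTensor.map_tmul, BTensor.map_tmul, BTensor.map_tmul]
        exact tmul_add m (f.hom y) (g.hom y))) z

/-- `Tor_t^R(M, -)`, the `t`-th left derived functor of `M ⊗_R -`, for a right `R`-module `M`. -/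
noncomputable def torFunctor (M : Type u) [AddCommGroup M] [Module Rᵐᵒᵖ M] (t : ℕ) :
    ModuleCat.{u} R ⥤ AddCommGrpCat.{u} :=
  (tensorAb R M).leftDerived t

end Functors

/-! ### Tensor powers of a bimodule and the tensor ring -/

/-- A bundled `R`-`R`-bimodule. -/
structure Bimodule (R : Type u) [Ring R] where
  carrier : Type u
  [addCommGroup : AddCommGroup carrier]
  [left : Module R carrier]
  [right : Module Rᵐᵒᵖ carrier]
  [comm : SMulCommClass R Rᵐᵒᵖ carrier]

attribute [instance] Bimodule.addCommGroup Bimodule.left Bimodule.right Bimodule.comm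

section TensorRing

variable (R : Type u) [Ring R]
variable (N : Type u) [AddCommGroup N] [Module R N] [Module Rᵐᵒᵖ N] [SMulCommClass R Rᵐᵒᵖ N]

/-- The bimodule `N ⊗_R X`, for a bimodule `X`. -/
def Bimodule.tensor (X : Bimodule R) : Bimodule R :=
  letI : Module Rᵐᵒᵖ (BTensor R N X.carrier) := BTensor.rightModule R N X.carrier R
  { carrier := BTensor R N X.carrier
    addCommGroup := inferInstance
    left := BTensor.leftModule R N X.carrier R
    right := BTensor.rightModule R N X.carrier R
    comm := ⟨fun r s z => by
      induction z using BTensor.induction with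
      | ht m y => rfl
      | ha a b iha ihb => simp only [smul_add, iha, ihb]⟩ }

/-- The tensor powers: `N^0 = R` and `N^(i+1) = N ⊗_R N^i`. -/
def tensorPow : ℕ → Bimodule R
  | 0 => { carrier := R }
  | i + 1 => Bimodule.tensor R N (tensorPow i)

/-- The underlying type of `N^i`. -/
abbrev TPow (i : ℕ) : Type u := (tensorPow R N i).carrier

/-- `N` is `m`-nilpotent: `N^(m+1) = 0`. -/
def IsNilpotentBimodule (m : ℕ) : Prop := Subsingleton (TPow R N (m + 1))

/-- The underlying abelian group `⨁ N^i` of the tensor ring `T_R(N)`. -/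
def TensorRing : Type u := ⨁ i : ℕ, TPow R N i

namespace TensorRing

instance : AddCommGroup (TensorRing R N) := inferInstanceAs (AddCommGroup (⨁ i : ℕ, TPow R N i))

instance leftModule : Module R (TensorRing R N) :=
  inferInstanceAs (Module R (⨁ i : ℕ, TPow R N i))

/-- The inclusion of `N^i`. -/
def of (i : ℕ) : TPow R N i →+ TensorRing R N := DirectSum.of (fun i => TPow R N i) i

/-- The additive map out of `T_R(N)` with given restrictions to all `N^i`. -/
def desc {A : Type*} [AddCommGroup A] (f : ∀ i, TPow R N i →+ A) : TensorRing R N →+ A :=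
  DirectSum.toAddMonoid f

variable {R N}

@[simp] theorem desc_of {A : Type*} [AddCommGroup A] (f : ∀ i, TPow R N i →+ A) (i : ℕ)
    (x : TPow R N i) : desc R N f (of R N i x) = f i x := DirectSum.toAddMonoid_of f i x

theorem smul_of (i : ℕ) (r : R) (x : TPow R N i) : r • of R N i x = of R N i (r • x) :=
  (DirectSum.of_smul (R := R) (M := fun i => TPow R N i) i r x).symm

theorem hom_ext {A : Type*} [AddCommGroup A] {f g : TensorRing R N →+ A}
    (h : ∀ i x, f (of R N i x) = g (of R N i x)) : f = g :=
  DirectSum.addHom_ext h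

/-- The pure tensor `n ⊗ x` in `N^(i+1)`, for `n` in `N` and `x` in `N^i`. -/
def cons {i : ℕ} (n : N) (x : TPow R N i) : TPow R N (i + 1) := tmul R n x

theorem pow_induction {i : ℕ} {p : TPow R N (i + 1) → Prop} (z : TPow R N (i + 1))
    (ht : ∀ (n : N) (x : TPow R N i), p (cons n x)) (ha : ∀ a b, p a → p b → p (a + b)) : p z :=
  BTensor.induction (R := R) (M := N) (Y := TPow R N i) z ht ha

variable (R N)

/-- Left multiplication by an element `n` of `N`: the map `x ↦ n ⊗ x` from `N^i` to `N^(i+1)`. -/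
def shift : N →+ TensorRing R N →+ TensorRing R N :=
  AddMonoidHom.mk' (fun n => desc R N (fun i => (of R N (i + 1)).comp
    (AddMonoidHom.mk' (fun x => cons n x) (fun x y => tmul_add n x y))))
    (fun n n' => hom_ext (fun i x => by
      simp only [desc_of, AddMonoidHom.add_apply, AddMonoidHom.comp_apply]
      rw [← map_add]
      exact congrArg _ (add_tmul n n' x)))

variable {R N}

@[simp] theorem shift_of (n : N) (i : ℕ) (x : TPow R N i) :
    shift R N n (of R N i x) = of R N (i + 1) (cons n x) := by
  simp only [shift, AddMonoidHom.mk'_apply, desc_of]; rfl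

theorem shift_op_smul (n : N) (r : R) (t : TensorRing R N) :
    shift R N (MulOpposite.op r • n) t = shift R N n (r • t) := by
  have : shift R N (MulOpposite.op r • n) =
      (shift R N n).comp (DistribSMul.toAddMonoidHom (TensorRing R N) r) :=
    hom_ext (fun i x => by
      simp only [shift_of, AddMonoidHom.comp_apply, DistribSMul.toAddMonoidHom_apply, smul_of]
      exact congrArg _ (tmul_balanced n r x))
  exact DFunLike.congr_fun this t

theorem shift_smul (n : N) (r : R) (t : TensorRing R N) :
    shift R N (r • n) t = r • shift R N n t := by
  have : shift R N (r • n) =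
      (DistribSMul.toAddMonoidHom (TensorRing R N) r).comp (shift R N n) :=
    hom_ext (fun i x => by
      simp only [shift_of, AddMonoidHom.comp_apply, DistribSMul.toAddMonoidHom_apply, smul_of]
      rfl)
  exact DFunLike.congr_fun this t

variable (R N)

/-- The left `R`-linear families of operators on `T_R(N)` parametrized by `N^i`. -/
abbrev Operators (i : ℕ) : Type u :=
  {f : TPow R N i →+ TensorRing R N →+ TensorRing R N //
    ∀ (r : R) (x : TPow R N i) (t : TensorRing R N), f (r • x) t = r • f x t}

/-- The action of `R` on `T_R(N)` by scalar multiplication. -/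
def smulHom : R →+ TensorRing R N →+ TensorRing R N :=
  AddMonoidHom.mk' (fun r => DistribSMul.toAddMonoidHom (TensorRing R N) r)
    (fun r s => by ext1 t; exact add_smul r s t)

/-- The elements `r` of `N^0 = R` act on `T_R(N)` by scalar multiplication. -/
def mulZero : Operators R N 0 :=
  ⟨smulHom R N, fun r (x : R) t => by
    change (r * x) • t = r • x • t
    exact mul_smul r x t⟩

variable {R N}

/-- If `x` in `N^i` acts by `f x`, then `n ⊗ x` acts by `f x` followed by `n ⊗ -`. -/
def mulStepHom {i : ℕ} (f : Operators R N i) :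
    TPow R N (i + 1) →+ TensorRing R N →+ TensorRing R N :=
  BTensor.lift (R := R) (M := N) (Y := TPow R N i)
    (AddMonoidHom.mk' (fun n => AddMonoidHom.mk' (fun x => (shift R N n).comp (f.1 x))
      (fun x y => by ext1 t; simp))
      (fun n n' => by ext1 x; ext1 t; simp))
    (fun n r x => by
      ext1 t
      exact (shift_op_smul n r _).trans (congrArg (shift R N n) (f.2 r x t).symm))

theorem mulStepHom_cons {i : ℕ} (f : Operators R N i) (n : N) (x : TPow R N i)
    (t : TensorRing R N) : mulStepHom f (cons n x) t = shift R N n (f.1 x t) := rfl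

theorem mulStepHom_smul {i : ℕ} (f : Operators R N i) (r : R) (z : TPow R N (i + 1))
    (t : TensorRing R N) : mulStepHom f (r • z) t = r • mulStepHom f z t := by
  induction z using pow_induction with
  | ht n x => exact shift_smul n r _
  | ha a b iha ihb =>
    rw [smul_add, map_add, AddMonoidHom.add_apply, iha, ihb, map_add, AddMonoidHom.add_apply,
      smul_add]

variable (R N)

/-- Left multiplication by the elements of `N^i`: the element `r` of `N^0 = R` acts by scalar
multiplication, and `n ⊗ x` acts by the action of `x` followed by `n ⊗ -`. -/
def mulPow : (i : ℕ) → Operators R N i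
  | 0 => mulZero R N
  | i + 1 => ⟨mulStepHom (mulPow i), mulStepHom_smul (mulPow i)⟩

/-- The multiplication of `T_R(N)`, given by `N^i × N^j → N^(i+j)`, the concatenation of
tensors. -/
def mul : TensorRing R N →+ TensorRing R N →+ TensorRing R N :=
  desc R N (fun i => (mulPow R N i).1)

variable {R N}

theorem mul_of_zero (r : R) (t : TensorRing R N) : mul R N (of R N 0 r) t = r • t :=
  DFunLike.congr_fun (desc_of (fun i => (mulPow R N i).1) 0 r) t

theorem mul_of_cons {i : ℕ} (n : N) (x : TPow R N i) (t : TensorRing R N) :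
    mul R N (of R N (i + 1) (cons n x)) t = shift R N n (mul R N (of R N i x) t) := by
  simp only [mul, desc_of]; rfl

theorem mul_smul_left (r : R) (s t : TensorRing R N) : mul R N (r • s) t = r • mul R N s t := by
  have : (mul R N).comp (DistribSMul.toAddMonoidHom (TensorRing R N) r) =
      (AddMonoidHom.compHom (DistribSMul.toAddMonoidHom (TensorRing R N) r)).comp (mul R N) :=
    hom_ext (fun i x => by
      ext1 t
      simp only [AddMonoidHom.comp_apply, DistribSMul.toAddMonoidHom_apply, smul_of,
        AddMonoidHom.compHom_apply_apply]
      simp only [mul, desc_of]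
      exact (mulPow R N i).2 r x t)
  exact DFunLike.congr_fun (DFunLike.congr_fun this s) t

theorem mul_shift (n : N) (s t : TensorRing R N) :
    mul R N (shift R N n s) t = shift R N n (mul R N s t) := by
  have : (mul R N).comp (shift R N n) =
      (AddMonoidHom.compHom (shift R N n)).comp (mul R N) :=
    hom_ext (fun i x => by
      ext1 t
      simp only [AddMonoidHom.comp_apply, shift_of, AddMonoidHom.compHom_apply_apply]
      exact mul_of_cons n x t)
  exact DFunLike.congr_fun (DFunLike.congr_fun this s) t

theorem induction {p : TensorRing R N → Prop} (t : TensorRing R N)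
    (h0 : ∀ r : R, p (of R N 0 r)) (hs : ∀ (n : N) (t : TensorRing R N), p t → p (shift R N n t))
    (ha : ∀ a b, p a → p b → p (a + b)) : p t := by
  have hof : ∀ (i : ℕ) (x : TPow R N i), p (of R N i x) := by
    intro i
    induction i with
    | zero => exact h0
    | succ i ih =>
      intro x
      induction x using pow_induction with
      | ht n x => rw [← shift_of]; exact hs n _ (ih x)
      | ha a b iha ihb => rw [map_add]; exact ha _ _ iha ihb
  refine DirectSum.induction_on (motive := p) t ?_ (fun i x => hof i x) ha
  have := hof 0 0
  rwa [map_zero] at this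

/-- The tensor ring `T_R(N)`. -/
instance ring : Ring (TensorRing R N) :=
  { (inferInstance : AddCommGroup (TensorRing R N)) with
    mul := fun a b => mul R N a b
    one := of R N 0 (1 : R)
    left_distrib := fun a b c => map_add (mul R N a) b c
    right_distrib := fun a b c => DFunLike.congr_fun (map_add (mul R N) a b) c
    zero_mul := fun a => DFunLike.congr_fun (map_zero (mul R N)) a
    mul_zero := fun a => map_zero (mul R N a)
    one_mul := fun a => (mul_of_zero (1 : R) a).trans (one_smul R a)
    mul_one := fun a => by
      change mul R N a (of R N 0 (1 : R)) = a
      induction a using induction with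
      | h0 r => exact (mul_of_zero r _).trans ((smul_of 0 r (1 : R)).trans (congrArg (of R N 0) (mul_one r)))
      | hs n t ih => rw [mul_shift, ih]
      | ha a b iha ihb => rw [map_add, AddMonoidHom.add_apply, iha, ihb]
    mul_assoc := fun a b c => by
      change mul R N (mul R N a b) c = mul R N a (mul R N b c)
      induction a using induction with
      | h0 r => rw [mul_of_zero, mul_of_zero, mul_smul_left]
      | hs n t ih => rw [mul_shift, mul_shift, mul_shift, ih]
      | ha x y ihx ihy => simp only [map_add, AddMonoidHom.add_apply, ihx, ihy] }

variable (R N)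

/-- The inclusion `R = N^0 → T_R(N)`. -/
def incl : R →+* TensorRing R N where
  toFun r := of R N 0 r
  map_one' := rfl
  map_mul' r s := ((mul_of_zero r _).trans (smul_of 0 r s)).symm
  map_zero' := map_zero (of R N 0)
  map_add' := map_add (of R N 0)

/-- `T_R(N)` is a right `R`-module along the inclusion of `R`. -/
instance rightModule : Module Rᵐᵒᵖ (TensorRing R N) :=
  Module.compHom (TensorRing R N) (incl R N).op

instance bimodule : SMulCommClass (TensorRing R N) Rᵐᵒᵖ (TensorRing R N) where
  smul_comm a r b := (mul_assoc a b (incl R N r.unop)).symm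

end TensorRing

/-- The induction functor `l = T_R(N) ⊗_R -`. -/
abbrev inductionFunctor : ModuleCat.{u} R ⥤ ModuleCat.{u} (TensorRing R N) :=
  tensorFunctor R (TensorRing R N) (TensorRing R N)

/-- The functor `N^i ⊗_R -` on left `R`-modules. -/
abbrev powFunctor (i : ℕ) : ModuleCat.{u} R ⥤ ModuleCat.{u} R :=
  tensorFunctor R R (TPow R N i)

end TensorRing

end SiltingTensor

set_option linter.unusedSectionVars false

namespace SiltingTensor

open Abelian

/-! ### Vanishing of `Ext` by dimension shifting -/

section ExtVanishing

variable {C : Type u} [Category.{v} C] [Abelian C] [HasExt.{v} C]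

/-! The argument is formal, given two adjoint pairs. The induction functor F = T ⊗_R - is left
adjoint to restriction G along R → T, and H = R ⊗_T - is left adjoint to restriction Z along the
augmentation T → R. The composite R → T → R is the identity, so restricting along Z and then along G
is the identity; by uniqueness of left adjoints, so is F followed by H. Hence every L is a retract
of G(F L), every R-module is G of some T-module, and statements about F Y descend to Y through Z and
H.

Silting: transposition gives X ∈ 𝒟_{Fσ} iff G X ∈ 𝒟_σ (`classD_map_iff`). With retracts, the
epimorphic counits and the preservation of coproducts, this reduces both silting conditions for F Y
to those for Y together with one condition on G(F Y) (`isSilting_map_iff`,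
`isPartialSilting_map_iff`).

Tilting: the Tor hypothesis becomes Ext^t(Y, G E) = 0 for injective E and 1 ≤ t ≤ n + 1
(`isAcyclicFor_of_isZero_tor`). Dimension shifting then compares the vanishing of Ext^t(F Y, X) and
of Ext^t(Y, G X) in these degrees (`subsingleton_ext_map_iff`); degree n + 1 controls projective
dimension. Add-coresolutions travel up along F and down along H, because finite coresolutions by
acyclic objects stay exact (`acyclic_map`).

Nilpotency enters twice. It makes G(F Y) a finite direct sum of the N^i ⊗ Y, so the condition on G(F
Y) splits into conditions on the summands; and it yields a Nakayama lemma, by which every projective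
T-module is induced (`exists_iso_induction`). -/

/-- Ext¹(X, S₁) is the cokernel of Hom(X, S₂) → Hom(X, S₃). The lifting form can be carried across
an adjunction, so no comparison map between Ext groups is needed. -/
theorem subsingleton_ext_one_iff {S : ShortComplex C} (hS : S.ShortExact) (X : C)
    (h : Subsingleton (Ext.{v} X S.X₂ 1)) :
    Subsingleton (Ext.{v} X S.X₁ 1) ↔ ∀ f : X ⟶ S.X₃, ∃ g : X ⟶ S.X₂, g ≫ S.g = f := by
  constructor
  · intro h₁ f
    obtain ⟨g, hg⟩ := Ext.covariant_sequence_exact₃ X hS (Ext.mk₀ f) (zero_add 1)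
      (Subsingleton.elim _ _)
    obtain ⟨g, rfl⟩ := Ext.addEquiv₀.symm.surjective g
    refine ⟨g, Ext.addEquiv₀.symm.injective ?_⟩
    simpa using hg
  · intro hf
    refine ⟨fun a b => ?_⟩
    have key : ∀ x : Ext.{v} X S.X₁ 1, x = 0 := fun x => by
      obtain ⟨y, rfl⟩ := Ext.covariant_sequence_exact₁ X hS x (Subsingleton.elim _ _) (zero_add 1)
      obtain ⟨y, rfl⟩ := Ext.addEquiv₀.symm.surjective y
      obtain ⟨g, rfl⟩ := hf y
      have : (Ext.addEquiv₀.symm (g ≫ S.g) : Ext.{v} X S.X₃ 0) =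
          (Ext.mk₀ g).comp (Ext.mk₀ S.g) (add_zero 0) := by simp
      rw [this, Ext.comp_assoc_of_second_deg_zero]
      simp
    rw [key a, key b]

/-- The connecting map lies between two vanishing Ext groups of the middle term. -/
theorem subsingleton_ext_succ_iff {S : ShortComplex C} (hS : S.ShortExact) (X : C) {k : ℕ}
    (h : Subsingleton (Ext.{v} X S.X₂ k)) (h' : Subsingleton (Ext.{v} X S.X₂ (k + 1))) :
    Subsingleton (Ext.{v} X S.X₁ (k + 1)) ↔ Subsingleton (Ext.{v} X S.X₃ k) := by
  constructor
  · intro h₁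
    refine ⟨fun a b => ?_⟩
    have key : ∀ x : Ext.{v} X S.X₃ k, x = 0 := fun x => by
      obtain ⟨y, rfl⟩ := Ext.covariant_sequence_exact₃ X hS x rfl (Subsingleton.elim _ _)
      rw [Subsingleton.elim y 0, Ext.zero_comp]
    rw [key a, key b]
  · intro h₃
    refine ⟨fun a b => ?_⟩
    have key : ∀ x : Ext.{v} X S.X₁ (k + 1), x = 0 := fun x => by
      obtain ⟨y, rfl⟩ := Ext.covariant_sequence_exact₁ X hS x (Subsingleton.elim _ _) rfl
      rw [Subsingleton.elim y 0, Ext.zero_comp]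
    rw [key a, key b]

theorem subsingleton_ext_of_retract {X Y : C} (r : Retract X Y) (L : C) (t : ℕ)
    (h : Subsingleton (Ext.{v} Y L t)) : Subsingleton (Ext.{v} X L t) := by
  refine ⟨fun a b => ?_⟩
  have key : ∀ x : Ext.{v} X L t, x = 0 := fun x => by
    have : x = (Ext.mk₀ r.i).comp ((Ext.mk₀ r.r).comp x (zero_add t)) (zero_add t) := by simp
    rw [this, Subsingleton.elim ((Ext.mk₀ r.r).comp x (zero_add t)) 0, Ext.comp_zero]
  rw [key a, key b]

/-- If the identity of `L` is a finite sum of endomorphisms that factor through objects `L' i`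
with `Ext^t(X, L' i) = 0`, then `Ext^t(X, L) = 0`. -/
theorem subsingleton_ext_of_sum_eq_id {ι : Type*} (s : Finset ι) {L : C} {L' : ι → C}
    (p : ∀ i, L ⟶ L' i) (j : ∀ i, L' i ⟶ L) (hs : ∑ i ∈ s, p i ≫ j i = 𝟙 L) (X : C) (t : ℕ)
    (h : ∀ i ∈ s, Subsingleton (Ext.{v} X (L' i) t)) : Subsingleton (Ext.{v} X L t) := by
  refine ⟨fun a b => ?_⟩
  have key : ∀ x : Ext.{v} X L t, x = 0 := fun x => by
    have h1 : x = x.comp (Ext.mk₀ (𝟙 L)) (add_zero t) := by simp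
    rw [h1, ← hs, show Ext.mk₀ (∑ i ∈ s, p i ≫ j i) = ∑ i ∈ s, Ext.mk₀ (p i ≫ j i) from
      map_sum Ext.addEquiv₀.symm _ _]
    refine (map_sum (x.precomp L (add_zero t)) _ s).trans (Finset.sum_eq_zero fun i hi => ?_)
    change x.comp (Ext.mk₀ (p i ≫ j i)) (add_zero t) = 0
    have := h i hi
    rw [← Ext.mk₀_comp_mk₀, ← Ext.comp_assoc_of_third_deg_zero,
      Subsingleton.elim (x.comp (Ext.mk₀ (p i)) (add_zero t)) 0, Ext.zero_comp]
  rw [key a, key b]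

theorem subsingleton_ext_of_retract_right {L L' : C} (r : Retract L L') (X : C) (t : ℕ)
    (h : Subsingleton (Ext.{v} X L' t)) : Subsingleton (Ext.{v} X L t) :=
  subsingleton_ext_of_sum_eq_id (Finset.univ : Finset Unit) (fun _ => r.i) (fun _ => r.r)
    (by simp) X t (fun _ _ => h)

theorem subsingleton_ext_of_isZero {X : C} (hX : IsZero X) (L : C) (t : ℕ) :
    Subsingleton (Ext.{v} X L t) := by
  refine ⟨fun a b => ?_⟩
  have key : ∀ x : Ext.{v} X L t, x = 0 := fun x => by
    have : x = (Ext.mk₀ (𝟙 X)).comp x (zero_add t) := by simp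
    rw [this, hX.eq_of_src (𝟙 X) 0, Ext.mk₀_zero, Ext.zero_comp]
  rw [key a, key b]

variable [EnoughInjectives C]

omit [HasExt.{v} C] in
/-- A short exact sequence `0 ⟶ L ⟶ E ⟶ L' ⟶ 0` with `E` injective. -/
theorem exists_injective_shortExact (L : C) :
    ∃ (E L' : C) (i : L ⟶ E) (p : E ⟶ L') (w : i ≫ p = 0),
      Injective E ∧ (ShortComplex.mk i p w).ShortExact := by
  obtain ⟨e⟩ := EnoughInjectives.presentation L
  exact ⟨e.J, _, e.f, cokernel.π e.f, cokernel.condition e.f, e.injective,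
    { exact := ShortComplex.exact_cokernel e.f, mono_f := e.mono, epi_g := inferInstance }⟩

/-- Shifting the second variable along injectives reduces to degree 1, where vanishing is a lifting
property and lifts on the summands assemble by the universal property. Exactness of coproducts is
not needed. -/
theorem subsingleton_ext_coproduct {ι : Type*} (f : ι → C) [HasCoproduct f] {t : ℕ} (ht : 1 ≤ t)
    (L : C) (h : ∀ i, Subsingleton (Ext.{v} (f i) L t)) : Subsingleton (Ext.{v} (∐ f) L t) := by
  induction t, ht using Nat.le_induction generalizing L with
  | base =>
    obtain ⟨E, L', i, p, w, hE, hS⟩ := exists_injective_shortExact L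
    have hE1 : ∀ X : C, Subsingleton (Ext.{v} X E 1) := fun X =>
      HasInjectiveDimensionLT.subsingleton E 1 1 le_rfl X
    refine (subsingleton_ext_one_iff hS _ (hE1 _)).2 fun g => ?_
    choose g' hg' using fun i => (subsingleton_ext_one_iff hS _ (hE1 _)).1 (h i) (Sigma.ι f i ≫ g)
    exact ⟨Sigma.desc g', Sigma.hom_ext _ _ fun i => by simpa using hg' i⟩
  | succ k hk ih =>
    obtain ⟨E, L', i, p, w, hE, hS⟩ := exists_injective_shortExact L
    have hE1 : ∀ (X : C) (j : ℕ), 1 ≤ j → Subsingleton (Ext.{v} X E j) := fun X j hj =>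
      HasInjectiveDimensionLT.subsingleton E 1 j hj X
    refine (subsingleton_ext_succ_iff hS _ (hE1 _ _ hk) (hE1 _ _ (by lia))).2 (ih L' fun i => ?_)
    exact (subsingleton_ext_succ_iff hS _ (hE1 _ _ hk) (hE1 _ _ (by lia))).1 (h i)

end ExtVanishing

/-! ### Acyclic objects for a left adjoint -/

section Acyclic

variable {C : Type u} [Category.{v} C] [Abelian C] [HasExt.{v} C]
variable {D : Type*} [Category.{v} D]

/-- `Ext^t(Y, G E) = 0` for all injective objects `E` and all `1 ≤ t ≤ k`. If `G` is exact with a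
left adjoint `F`, this says that the left derived functors of `F` vanish on `Y` in the degrees
`1, …, k`. -/
def IsAcyclicFor (G : D ⥤ C) (k : ℕ) (Y : C) : Prop :=
  ∀ E : D, Injective E → ∀ t : ℕ, 1 ≤ t → t ≤ k → Subsingleton (Ext.{v} Y (G.obj E) t)

theorem IsAcyclicFor.of_retract {G : D ⥤ C} {k : ℕ} {X Y : C} (h : IsAcyclicFor G k Y)
    (r : Retract X Y) : IsAcyclicFor G k X := fun E hE t h₁ h₂ =>
  subsingleton_ext_of_retract r _ t (h E hE t h₁ h₂)

theorem IsAcyclicFor.coproduct [EnoughInjectives C] {G : D ⥤ C} {k : ℕ} {ι : Type*} (f : ι → C)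
    [HasCoproduct f] (h : ∀ i, IsAcyclicFor G k (f i)) : IsAcyclicFor G k (∐ f) :=
  fun E hE t h₁ h₂ => subsingleton_ext_coproduct f h₁ _ fun i => h i E hE t h₁ h₂

theorem IsAcyclicFor.of_addClosure [EnoughInjectives C] [HasCoproducts.{v} C] {G : D ⥤ C} {k : ℕ}
    {X Y : C} (h : IsAcyclicFor G k Y) (hX : addClosure Y X) : IsAcyclicFor G k X := by
  obtain ⟨I, ⟨r⟩⟩ := hX
  exact (IsAcyclicFor.coproduct _ fun _ => h).of_retract r

variable [Abelian D] {F : C ⥤ D} {G : D ⥤ C} (adj : F ⊣ G)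

include adj in
/-- An object is acyclic for `F` if `F` keeps a projective resolution exact. -/
theorem IsAcyclicFor.of_projectiveResolution [F.PreservesZeroMorphisms] {k : ℕ} {Y : C}
    (P : ProjectiveResolution Y)
    (h : ∀ s : ℕ, s + 1 ≤ k → (ShortComplex.mk (F.map (P.complex.d (s + 1 + 1) (s + 1)))
      (F.map (P.complex.d (s + 1) s)) (by rw [← F.map_comp]; simp)).Exact) :
    IsAcyclicFor G k Y := by
  intro E hE t ht htk
  obtain ⟨s, rfl⟩ : ∃ s, t = s + 1 := ⟨t - 1, by lia⟩
  refine ⟨fun a b => ?_⟩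
  have key : ∀ x : Ext.{v} Y (G.obj E) (s + 1), x = 0 := fun x => by
    -- A cocycle P_{s+1} ⟶ G E transposes to F P_{s+1} ⟶ E, extends along F P_{s+1} ⟶ F P_s because
    -- E is injective, and transposes back to a coboundary.
    obtain ⟨f, hf, rfl⟩ := P.extMk_surjective x (s + 1 + 1) rfl
    refine (P.extMk_eq_zero_iff f _ rfl hf s rfl).2 ?_
    have hf' : F.map (P.complex.d (s + 1 + 1) (s + 1)) ≫ (adj.homEquiv _ _).symm f = 0 := by
      rw [← adj.homEquiv_naturality_left_symm, hf]
      simp [Adjunction.homEquiv_counit]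
    refine ⟨adj.homEquiv _ _ ((h s htk).descToInjective _ hf'), ?_⟩
    rw [← adj.homEquiv_naturality_left]
    erw [(h s htk).comp_descToInjective]
    simp
  rw [key a, key b]

include adj in
-- Embed X in an injective E. Since G is exact and Ext^t(Y, G E) = 0 in the range, both sides shift
-- in parallel down to degree 1, where the two lifting properties are adjoint to each other.
theorem subsingleton_ext_map_iff [HasExt.{v} D] [EnoughInjectives D]
    [PreservesFiniteColimits G] {k : ℕ} {Y : C}
    (hY : IsAcyclicFor G k Y) {t : ℕ} (ht : 1 ≤ t) (htk : t ≤ k) (X : D) :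
    Subsingleton (Ext.{v} (F.obj Y) X t) ↔ Subsingleton (Ext.{v} Y (G.obj X) t) := by
  have := adj.isRightAdjoint
  have := adj.rightAdjoint_preservesLimits
  induction t, ht using Nat.le_induction generalizing X with
  | base =>
    obtain ⟨E, L', i, p, w, hE, hS⟩ := exists_injective_shortExact X
    have hE1 : Subsingleton (Ext.{v} (F.obj Y) E 1) :=
      HasInjectiveDimensionLT.subsingleton E 1 1 le_rfl _
    refine (subsingleton_ext_one_iff hS _ hE1).trans (Iff.trans ?_
      (subsingleton_ext_one_iff (hS.map_of_exact G) Y (hY E hE 1 le_rfl htk)).symm)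
    change (∀ f : F.obj Y ⟶ L', ∃ g : F.obj Y ⟶ E, g ≫ p = f) ↔
      ∀ f : Y ⟶ G.obj L', ∃ g : Y ⟶ G.obj E, g ≫ G.map p = f
    constructor
    · intro h f
      obtain ⟨g, hg⟩ := h ((adj.homEquiv _ _).symm f)
      exact ⟨adj.homEquiv _ _ g, by
        rw [← adj.homEquiv_naturality_right, hg, Equiv.apply_symm_apply]⟩
    · intro h f
      obtain ⟨g, hg⟩ := h (adj.homEquiv _ _ f)
      exact ⟨(adj.homEquiv _ _).symm g, by
        rw [← adj.homEquiv_naturality_right_symm, hg, Equiv.symm_apply_apply]⟩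
  | succ j hj ih =>
    obtain ⟨E, L', i, p, w, hE, hS⟩ := exists_injective_shortExact X
    have hE1 : ∀ j : ℕ, 1 ≤ j → Subsingleton (Ext.{v} (F.obj Y) E j) := fun j hj =>
      HasInjectiveDimensionLT.subsingleton E 1 j hj _
    exact (subsingleton_ext_succ_iff hS _ (hE1 _ hj) (hE1 _ (by lia))).trans
      ((ih (by lia) L').trans (subsingleton_ext_succ_iff (hS.map_of_exact G) Y
        (hY E hE j hj (by lia)) (hY E hE (j + 1) (by lia) htk)).symm)

omit [HasExt.{v} C] in
-- It suffices to test on one injective containing the cokernel of `S.f`: factoring through `S.g`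
-- forces the kernel of `S.g` to die in that cokernel.
theorem exact_of_forall_injective [EnoughInjectives D] (S : ShortComplex D)
    (h : ∀ (E : D) (_ : Injective E) (f : S.X₂ ⟶ E), S.f ≫ f = 0 → ∃ g, S.g ≫ g = f) : S.Exact := by
  obtain ⟨e⟩ := EnoughInjectives.presentation (cokernel S.f)
  have := e.mono
  obtain ⟨g, hg⟩ := h e.J e.injective (cokernel.π S.f ≫ e.f) (by simp)
  rw [S.exact_iff_kernel_ι_comp_cokernel_π_zero, ← cancel_mono e.f, Category.assoc, ← hg]
  simp

omit [HasExt.{v} C] in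
theorem shortExact_cycles {K : CochainComplex C ℕ} (hK : K.Acyclic) (j : ℕ) :
    (ShortComplex.mk (K.iCycles j) (K.toCycles j (j + 1))
      (by rw [← cancel_mono (K.iCycles (j + 1))]; simp)).ShortExact := by
  have h1 : Epi (K.toCycles j (j + 1)) := by
    have := (hK (j + 1))
    rw [HomologicalComplex.exactAt_iff' K j (j + 1) (j + 1 + 1) (by simp) (by simp)] at this
    have := this.epi_toCycles
    rw [← K.toCycles_cyclesIsoSc'_hom j (j + 1) (j + 1 + 1) (by simp) (by simp)] at this
    have h2 : K.toCycles j (j + 1) = (K.toCycles j (j + 1) ≫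
      (K.cyclesIsoSc' j (j + 1) (j + 1 + 1) (by simp) (by simp)).hom) ≫
      (K.cyclesIsoSc' j (j + 1) (j + 1 + 1) (by simp) (by simp)).inv := by
      rw [Category.assoc, Iso.hom_inv_id, Category.comp_id]
    rw [h2]
    exact epi_comp' this inferInstance
  refine { exact := ShortComplex.exact_of_f_is_kernel _ ?_ }
  refine KernelFork.IsLimit.ofι' _ _ fun {A} k hk => 
    ⟨K.liftCycles k (j + 1) (by simp) ?_, K.liftCycles_i k (j + 1) (by simp) _⟩
  rw [← K.toCycles_i]
  exact (reassoc_of% hk) _ |>.trans zero_comp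

omit [Abelian D] in
-- Descending induction on j: Ext^t(Z^j, G E) lies between Ext^t(K^j, G E) = 0 and
-- Ext^{t+1}(Z^{j+1}, G E), and the cycles vanish above degree n + 1. The bound t ≤ j survives the
-- step, keeps t within the acyclicity range, and excludes j = 0, where K⁰ need not be acyclic for
-- F.
theorem subsingleton_ext_cycles {K : CochainComplex C ℕ} (hK : K.Acyclic) (n : ℕ)
    (hz : ∀ j, n + 1 < j → IsZero (K.X j))
    (hA : ∀ j, j ≤ n → IsAcyclicFor G (n + 1) (K.X (j + 1))) (E : D) (hE : Injective E)
    (j t : ℕ) (ht : 1 ≤ t) (htj : t ≤ j) : Subsingleton (Ext.{v} (K.cycles j) (G.obj E) t) := by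
  by_cases hj : n + 1 < j
  · exact subsingleton_ext_of_isZero (IsZero.of_mono (K.iCycles j) (hz j hj)) _ _
  · obtain ⟨i, rfl⟩ : ∃ i, j = i + 1 := ⟨j - 1, by lia⟩
    refine ⟨fun a b => ?_⟩
    have key : ∀ x : Ext.{v} (K.cycles (i + 1)) (G.obj E) t, x = 0 := fun x => by
      have h1 := subsingleton_ext_cycles hK n hz hA E hE (i + 1 + 1) (1 + t) (by lia) (by lia)
      have h2 := hA i (by lia) E hE t ht (by lia)
      obtain ⟨y, rfl⟩ := Ext.contravariant_sequence_exact₁ (shortExact_cycles hK (i + 1)) (G.obj E)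
        x rfl (Subsingleton.elim _ _)
      have : y = 0 := Subsingleton.elim _ _
      rw [this, Ext.comp_zero]
    rw [key a, key b]
termination_by n + 2 - j

include adj in
/-- A left adjoint keeps a finite coresolution by acyclic objects exact. -/
theorem acyclic_map [EnoughInjectives D] [F.PreservesZeroMorphisms]
    {K : CochainComplex C ℕ} (hK : K.Acyclic) (n : ℕ)
    (hz : ∀ j, n + 1 < j → IsZero (K.X j))
    (hA : ∀ j, j ≤ n → IsAcyclicFor G (n + 1) (K.X (j + 1))) :
    ((F.mapHomologicalComplex _).obj K).Acyclic := by
  intro j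
  have := adj.isRightAdjoint
  refine exact_of_forall_injective _ fun E hE f hf => ?_
  have hn : (ComplexShape.up ℕ).next j = j + 1 := by simp
  change F.obj (K.X j) ⟶ E at f
  change F.map (K.d _ j) ≫ f = 0 at hf
  change ∃ g, F.map (K.d j _) ≫ g = f
  rw [hn]
  have hS := shortExact_cycles hK j
  have hS' := shortExact_cycles hK (j + 1)
  have := hS.epi_g
  have h0 : adj.homEquiv (K.X ((ComplexShape.up ℕ).prev j)) E 0 = 0 := by
    simp [Adjunction.homEquiv_unit]
  -- Exactness of K at j turns the vanishing on boundaries into vanishing on cycles, so the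
  -- transpose of f factors through the cycles in degree j + 1.
  have hf' : K.iCycles j ≫ adj.homEquiv _ _ f = 0 := by
    have := (hK j).epi_toCycles
    refine (cancel_epi (K.sc j).toCycles).1 (Eq.trans ?_ comp_zero.symm)
    refine ((K.sc j).toCycles_i_assoc _).trans ?_
    exact (adj.homEquiv_naturality_left _ _).symm.trans
      ((congrArg (adj.homEquiv _ _) hf).trans h0)
  obtain ⟨g, hg⟩ : ∃ g, K.toCycles j (j + 1) ≫ g = adj.homEquiv _ _ f :=
    ⟨hS.exact.desc _ hf', hS.exact.g_desc _ hf'⟩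
  -- Ext¹(Z^{j+2}, G E) = 0 is the obstruction to extending g from Z^{j+1} to K^{j+1}.
  have h1 := subsingleton_ext_cycles hK n hz hA E hE (j + 1 + 1) 1 le_rfl (by lia)
  obtain ⟨g', hg'⟩ := Ext.contravariant_sequence_exact₁ hS' (G.obj E) (Ext.mk₀ g) (add_zero 1)
    (Subsingleton.elim _ _)
  obtain ⟨g', rfl⟩ := Ext.addEquiv₀.symm.surjective g'
  have hg'' : K.iCycles (j + 1) ≫ g' = g := Ext.addEquiv₀.symm.injective (by simpa using hg')
  refine ⟨(adj.homEquiv _ _).symm g', (adj.homEquiv _ _).injective ?_⟩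
  rw [adj.homEquiv_naturality_left, Equiv.apply_symm_apply, ← hg, ← hg'', ← K.toCycles_i,
    Category.assoc]

end Acyclic

/-! ### Silting objects and adjunctions -/

section Silting

variable {C : Type*} [Category.{v} C] [Abelian C]

theorem classD_of_epi {P₁ P₀ : C} [Projective P₁] (σ : P₁ ⟶ P₀) {X Y : C} (f : X ⟶ Y) [Epi f]
    (h : classD σ X) : classD σ Y := fun g => by
  obtain ⟨k, hk⟩ := h (Projective.factorThru g f)
  exact ⟨k ≫ f, by simpa using congrArg (· ≫ f) hk⟩

theorem classD_of_sum_eq_id {P₁ P₀ : C} (σ : P₁ ⟶ P₀) {ι : Type*} (s : Finset ι) {L : C}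
    {L' : ι → C} (p : ∀ i, L ⟶ L' i) (j : ∀ i, L' i ⟶ L) (hs : ∑ i ∈ s, p i ≫ j i = 𝟙 L)
    (h : ∀ i ∈ s, classD σ (L' i)) : classD σ L := fun g => by
  have : ∀ i, ∃ k : P₀ ⟶ L, i ∈ s → σ ≫ k = g ≫ p i ≫ j i := fun i => by
    by_cases hi : i ∈ s
    · obtain ⟨k, hk⟩ := h i hi (g ≫ p i)
      exact ⟨k ≫ j i, fun _ => by simpa using congrArg (· ≫ j i) hk⟩
    · exact ⟨0, fun h => (hi h).elim⟩
  choose k hk using this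
  refine ⟨∑ i ∈ s, k i, ?_⟩
  change σ ≫ _ = g
  rw [Preadditive.comp_sum, Finset.sum_congr rfl hk, ← Preadditive.comp_sum, hs, Category.comp_id]

theorem classD_of_retract {P₁ P₀ : C} (σ : P₁ ⟶ P₀) {L L' : C} (r : Retract L L')
    (h : classD σ L') : classD σ L :=
  classD_of_sum_eq_id σ (Finset.univ : Finset Unit) (fun _ => r.i) (fun _ => r.r) (by simp)
    (fun _ _ => h)

/-- Projectivity of P₁ gives closure under quotients and that of P₀ closure under extensions, so
only coproducts carry a condition. -/
theorem isTorsionClass_classD_iff [HasCoproducts.{v} C] {P₁ P₀ : C} [Projective P₁]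
    [Projective P₀] (σ : P₁ ⟶ P₀) :
    IsTorsionClass (classD σ) ↔
      ∀ (I : Type v) (L : I → C), (∀ i, classD σ (L i)) → classD σ (∐ L) := by
  have hiso : (classD σ).IsClosedUnderIsomorphisms :=
    ⟨fun e h => classD_of_epi σ e.hom h⟩
  constructor
  · intro h I L hL
    have := h.closedCoproducts I
    exact ObjectProperty.prop_colimit _ (Discrete.functor L) fun j => hL j.as
  · intro h
    refine ⟨hiso, ⟨fun f _ hX => classD_of_epi σ f hX⟩, ⟨fun {S} hS h₁ h₃ g => ?_⟩,
      fun I => ObjectProperty.IsClosedUnderColimitsOfShape.mk' ?_⟩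
    · have := hS.epi_g
      have := hS.mono_f
      -- Extend the image of g in the quotient along σ and lift the result over P₀; the error then
      -- lands in the subobject, where it extends along σ as well.
      obtain ⟨k, hk⟩ := h₃ (g ≫ S.g)
      have hk' : (g - σ ≫ Projective.factorThru k S.g) ≫ S.g = 0 := by
        simpa [sub_eq_zero] using hk.symm
      obtain ⟨k', hk'⟩ := h₁ (hS.exact.lift _ hk')
      refine ⟨k' ≫ S.f + Projective.factorThru k S.g, ?_⟩
      have := congrArg (· ≫ S.f) hk'
      simp only [Category.assoc, hS.exact.lift_f] at this
      simp [this]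
    · rintro _ ⟨K, hK⟩
      have := h I (fun i => K.obj ⟨i⟩) fun i => hK _
      exact hiso.of_iso (HasColimit.isoOfNatIso (Discrete.natIsoFunctor (F := K))).symm this

theorem Gen.of_epi [HasCoproducts.{v} C] {X L L' : C} (h : Gen X L) (f : L ⟶ L') [Epi f] :
    Gen X L' := by
  obtain ⟨I, p, hp⟩ := h
  exact ⟨I, p ≫ f, epi_comp p f⟩

theorem Gen.self [HasCoproducts.{v} C] (X : C) : Gen X X :=
  ⟨PUnit, Sigma.desc fun _ => 𝟙 X, ⟨fun f g h => by
    simpa using congrArg (Sigma.ι (fun _ : PUnit.{v + 1} => X) PUnit.unit ≫ ·) h⟩⟩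

theorem Gen.coproduct [HasCoproducts.{v} C] {X : C} {I : Type v} {L : I → C}
    (h : ∀ i, Gen X (L i)) : Gen X (∐ L) := by
  choose J p hp using h
  refine ⟨Σ i, J i, Sigma.desc fun k => Sigma.ι (fun _ : J k.1 => X) k.2 ≫ p k.1 ≫ Sigma.ι L k.1,
    ⟨fun f g hfg => Sigma.hom_ext _ _ fun i => (cancel_epi (p i)).1 (Sigma.hom_ext _ _ fun j => ?_)⟩⟩
  simpa using congrArg (Sigma.ι (fun _ : Σ i, J i => X) ⟨i, j⟩ ≫ ·) hfg

variable {D : Type*} [Category.{v} D] [Abelian D]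
variable {F : C ⥤ D} {G : D ⥤ C} (adj : F ⊣ G)

include adj in
-- Under the adjunction, Hom(F σ, X) is the map Hom(σ, G X).
theorem classD_map_iff {P₁ P₀ : C} (σ : P₁ ⟶ P₀) (X : D) :
    classD (F.map σ) X ↔ classD σ (G.obj X) := by
  constructor
  · intro h f
    obtain ⟨g, hg⟩ := h ((adj.homEquiv _ _).symm f)
    refine ⟨adj.homEquiv _ _ g, ?_⟩
    change _ ≫ _ = _ at hg ⊢
    rw [← adj.homEquiv_naturality_left, hg, Equiv.apply_symm_apply]
  · intro h f
    obtain ⟨g, hg⟩ := h (adj.homEquiv _ _ f)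
    refine ⟨(adj.homEquiv _ _).symm g, ?_⟩
    change _ ≫ _ = _ at hg ⊢
    rw [← adj.homEquiv_naturality_left_symm, hg, Equiv.symm_apply_apply]

include adj in
theorem IsProjectivePresentation.map [G.PreservesEpimorphisms] {P₁ P₀ X : C} {σ : P₁ ⟶ P₀}
    (h : IsProjectivePresentation σ X) : IsProjectivePresentation (F.map σ) (F.obj X) := by
  obtain ⟨h₁, h₀, π, w, hex, hπ⟩ := h
  have : PreservesColimitsOfSize.{v, v} F := adj.leftAdjoint_preservesColimits
  have := adj.isLeftAdjoint
  exact ⟨adj.map_projective _ h₁, adj.map_projective _ h₀, F.map π, by rw [← F.map_comp, w, F.map_zero],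
    hex.map_of_epi_of_preservesCokernel F hπ inferInstance, inferInstance⟩

include adj in
theorem Gen.map [HasCoproducts.{v} C] [HasCoproducts.{v} D] {X L : C} (h : Gen X L) :
    Gen (F.obj X) (F.obj L) := by
  obtain ⟨I, p, hp⟩ := h
  have : PreservesColimitsOfSize.{v, v} F := adj.leftAdjoint_preservesColimits
  have := adj.isLeftAdjoint
  exact ⟨I, (PreservesCoproduct.iso F fun _ : I => X).inv ≫ F.map p, epi_comp _ _⟩

include adj in
theorem addClosure.map [HasCoproducts.{v} C] [HasCoproducts.{v} D] {X L : C}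
    (h : addClosure X L) : addClosure (F.obj X) (F.obj L) := by
  obtain ⟨I, ⟨r⟩⟩ := h
  have : PreservesColimitsOfSize.{v, v} F := adj.leftAdjoint_preservesColimits
  exact ⟨I, ⟨(r.map F).trans (Retract.ofIso (PreservesCoproduct.iso F fun _ : I => X))⟩⟩

theorem addClosure.of_iso [HasCoproducts.{v} C] {X X' L : C} (h : addClosure X L) (e : X ≅ X') :
    addClosure X' L := by
  obtain ⟨I, ⟨r⟩⟩ := h
  exact ⟨I, ⟨r.trans (Retract.ofIso (Sigma.mapIso fun _ => e))⟩⟩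

theorem Gen.of_iso [HasCoproducts.{v} C] {X X' L : C} (h : Gen X L) (e : X ≅ X') :
    Gen X' L := by
  obtain ⟨I, p, hp⟩ := h
  exact ⟨I, (Sigma.mapIso fun _ => e).inv ≫ p, epi_comp _ _⟩

variable {Z : C ⥤ D} (e : Z ⋙ G ≅ 𝟭 C)

/-- If `Z` is a section of the right adjoint `G` of `F`, then every object `L` is a retract of
`G (F L)`. -/
def retractUnit (L : C) : Retract L (G.obj (F.obj L)) where
  i := adj.unit.app L
  r := G.map ((adj.homEquiv _ _).symm (e.inv.app L)) ≫ e.hom.app L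
  retract := by
    rw [← Category.assoc, ← adj.homEquiv_unit, Equiv.apply_symm_apply]
    simp

variable [PreservesColimitsOfSize.{v, v} G] [HasCoproducts.{v} C] [HasCoproducts.{v} D]

include adj e in
-- Closure under coproducts passes upward because G preserves them, and downward by applying it to
-- the objects Z Lᵢ, since G Z Lᵢ ≅ Lᵢ. Membership of Y follows from that of G(F Y), of which Y is a
-- retract.
theorem isPartialSilting_map_iff [PreservesColimitsOfSize.{v, v} Z] {P₁ P₀ Y : C} {σ : P₁ ⟶ P₀}
    (hσ : IsProjectivePresentation σ Y) :
    IsPartialSilting (F.map σ) (F.obj Y) ↔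
      IsPartialSilting σ Y ∧ classD σ (G.obj (F.obj Y)) := by
  have : G.PreservesEpimorphisms := preservesEpimorphisms_of_preservesColimitsOfShape G
  have hσ' := hσ.map adj
  have := hσ.1
  have := hσ.2.1
  have := hσ'.1
  have := hσ'.2.1
  constructor
  · intro h
    have h1 := (classD_map_iff adj σ _).1 h.mem
    refine ⟨⟨hσ, classD_of_retract σ (retractUnit adj e Y) h1,
      (isTorsionClass_classD_iff σ).2 fun I L hL => ?_⟩, h1⟩
    have h2 := (isTorsionClass_classD_iff (F.map σ)).1 h.torsion I (fun i => Z.obj (L i)) fun i =>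
      (classD_map_iff adj σ _).2 (classD_of_epi σ (e.inv.app (L i)) (hL i))
    exact classD_of_epi σ ((G.mapIso (PreservesCoproduct.iso Z L)).inv ≫ e.hom.app (∐ L))
      ((classD_map_iff adj σ _).1 h2)
  · rintro ⟨h, h1⟩
    refine ⟨hσ', (classD_map_iff adj σ _).2 h1, (isTorsionClass_classD_iff _).2 fun I L hL => ?_⟩
    refine (classD_map_iff adj σ _).2 ?_
    exact classD_of_epi σ (PreservesCoproduct.iso G L).inv
      ((isTorsionClass_classD_iff σ).1 h.torsion I (fun i => G.obj (L i)) fun i =>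
        (classD_map_iff adj σ _).1 (hL i))

variable {H : D ⥤ C} (adj' : H ⊣ Z)

include adj adj' e in
/-- A left adjoint of a section of `G` is a retraction of `F`. -/
def compIsoId : F ⋙ H ≅ 𝟭 C :=
  ((adj.comp adj').ofNatIsoRight e).leftAdjointUniq Adjunction.id

include adj adj' e in
-- Downward, L ∈ Gen Y gives F L ∈ Gen(F Y), hence G(F L) and its retract L lie in 𝒟_σ. Conversely,
-- L ∈ 𝒟_σ gives Z L ∈ Gen(F Y); apply H, use H F Y ≅ Y, and descend along H Z L ⟶ L, which is epi
-- because Z is faithful. Upward, X is a quotient of F(G X).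
theorem isSilting_map_iff [∀ X, Epi (adj.counit.app X)] {P₁ P₀ Y : C} {σ : P₁ ⟶ P₀}
    (hσ : IsProjectivePresentation σ Y) :
    IsSilting (F.map σ) (F.obj Y) ↔ IsSilting σ Y ∧ Gen Y (G.obj (F.obj Y)) := by
  have : G.PreservesEpimorphisms := preservesEpimorphisms_of_preservesColimitsOfShape G
  have hσ' := hσ.map adj
  have := hσ.1
  have := hσ'.1
  constructor
  · intro h
    have h1 : Gen Y = classD σ := by
      ext L
      constructor
      · intro hL
        have h2 := hL.map adj
        rw [h.gen_eq, classD_map_iff adj] at h2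
        exact classD_of_retract σ (retractUnit adj e L) h2
      · intro hL
        have h2 : Gen (F.obj Y) (Z.obj L) := by
          rw [h.gen_eq, classD_map_iff adj]
          exact classD_of_epi σ (e.inv.app L) hL
        have : (Z ⋙ G).Faithful := Functor.Faithful.of_iso e.symm
        have : Z.Faithful := Functor.Faithful.of_comp Z G
        exact ((h2.map adj').of_iso ((compIsoId adj e adj').app Y)).of_epi (adj'.counit.app L)
    refine ⟨⟨hσ, h1⟩, ?_⟩
    rw [h1, ← classD_map_iff adj, ← h.gen_eq]
    exact Gen.self _
  · rintro ⟨h, h1⟩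
    refine ⟨hσ', ?_⟩
    ext X
    constructor
    · rintro ⟨I, p, hp⟩
      refine classD_of_epi _ p ((classD_map_iff adj σ _).2 ?_)
      have h2 : Gen Y (∐ fun _ : I => G.obj (F.obj Y)) := Gen.coproduct fun _ => h1
      rw [h.gen_eq] at h2
      exact classD_of_epi σ (PreservesCoproduct.iso G fun _ : I => F.obj Y).inv h2
    · intro hX
      rw [classD_map_iff adj, ← h.gen_eq] at hX
      exact (hX.map adj).of_epi (adj.counit.app X)

end Silting

/-! ### Tilting objects and adjunctions -/

section Tilting

variable {C : Type*} [Category.{v} C] [Abelian C] [HasCoproducts.{v} C]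
variable {D : Type*} [Category.{v} D] [Abelian D] [HasCoproducts.{v} D]

theorem HasAddCoresolution.of_iso {n : ℕ} {X X' P P' : C} (h : HasAddCoresolution n X P)
    (e : X ≅ X') (e' : P ≅ P') : HasAddCoresolution n X' P' := by
  obtain ⟨K, hK, ⟨i⟩, hadd, hz⟩ := h
  exact ⟨K, hK, ⟨i ≪≫ e'⟩, fun j hj => (hadd j hj).of_iso e, hz⟩

variable [HasExt.{v} C] [EnoughInjectives C] [EnoughInjectives D]
variable {F : C ⥤ D} {G : D ⥤ C} (adj : F ⊣ G)

include adj in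
theorem HasAddCoresolution.map {n : ℕ} {X P : C} (h : HasAddCoresolution n X P)
    (hX : IsAcyclicFor G (n + 1) X) : HasAddCoresolution n (F.obj X) (F.obj P) := by
  obtain ⟨K, hK, ⟨i⟩, hadd, hz⟩ := h
  have := adj.isLeftAdjoint
  exact ⟨(F.mapHomologicalComplex _).obj K,
    acyclic_map adj hK n hz fun j hj => hX.of_addClosure (hadd j hj),
    ⟨F.mapIso i⟩, fun j hj => (hadd j hj).map adj, fun j hj => F.map_isZero (hz j hj)⟩

variable [HasExt.{v} D] [PreservesFiniteColimits G] {Z : C ⥤ D} (e : Z ⋙ G ≅ 𝟭 C)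

include adj e in
-- Projective dimension is tested by Ext^{n+1} alone, which is why acyclicity is required up to n +
-- 1. To descend, test on Z L, as G Z L ≅ L. Self-extensions in degrees above n vanish by the
-- dimension bound.
theorem isPartialTilting_map_iff {n : ℕ} {Y : C} (hY : IsAcyclicFor G (n + 1) Y) :
    IsPartialTilting n (F.obj Y) ↔ IsPartialTilting n Y ∧ perpN n Y (G.obj (F.obj Y)) := by
  constructor
  · intro h
    have hpd : HasProjectiveDimensionLE Y n :=
      hasProjectiveDimensionLT_of_enoughInjectives Y (n + 1) fun L => by
        have h1 := (subsingleton_ext_map_iff adj hY (by lia : 1 ≤ n + 1) le_rfl (Z.obj L)).1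
          (h.pd_le.subsingleton _ (n + 1) _ le_rfl _)
        exact subsingleton_ext_of_retract_right (Retract.ofIso (e.app L).symm) _ _ h1
    have h1 : perpN n Y (G.obj (F.obj Y)) := fun j hj hjn =>
      (subsingleton_ext_map_iff adj hY hj (by lia) _).1 (h.ext_self j hj)
    refine ⟨⟨hpd, fun j hj => ?_⟩, h1⟩
    by_cases hjn : j ≤ n
    · exact subsingleton_ext_of_retract_right (retractUnit adj e Y) _ _ (h1 j hj hjn)
    · exact hpd.subsingleton _ (n + 1) j (by lia) _
  · rintro ⟨h, h1⟩
    have hpd : HasProjectiveDimensionLE (F.obj Y) n :=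
      hasProjectiveDimensionLT_of_enoughInjectives _ (n + 1) fun L =>
        (subsingleton_ext_map_iff adj hY (by lia : 1 ≤ n + 1) le_rfl L).2
          (h.pd_le.subsingleton _ (n + 1) _ le_rfl _)
    refine ⟨hpd, fun j hj => ?_⟩
    by_cases hjn : j ≤ n
    · exact (subsingleton_ext_map_iff adj hY hj (by lia) _).2 (h1 j hj hjn)
    · exact hpd.subsingleton _ (n + 1) j (by lia) _

include adj e in
/-- If `Z` is a section of `G` and `Y` is acyclic for the left adjoint `F` of `G`, then `F Y` is
acyclic for the left adjoint of `Z`. -/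
theorem isAcyclicFor_section {n : ℕ} {Y : C} (hY : IsAcyclicFor G n Y) :
    IsAcyclicFor Z n (F.obj Y) := fun E hE t h₁ h₂ => by
  refine (subsingleton_ext_map_iff adj hY h₁ h₂ _).2 ?_
  exact subsingleton_ext_of_retract_right (Retract.ofIso (e.app E)) _ _
    (HasInjectiveDimensionLT.subsingleton E 1 t h₁ _)

variable {H : D ⥤ C} (adj' : H ⊣ Z)

include adj adj' e in
-- A coresolution of F P by Add(F Y) is carried by H to one of H F P ≅ P by Add Y, since F Y is
-- acyclic for H. Upward, F carries coresolutions over, and `hproj` ensures that every projective is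
-- reached.
theorem isTilting_map_iff [G.PreservesEpimorphisms]
    (hproj : ∀ Q : D, Projective Q → ∃ P : C, Projective P ∧ Nonempty (F.obj P ≅ Q)) {n : ℕ}
    {Y : C} (hY : IsAcyclicFor G (n + 1) Y) :
    IsTilting n (F.obj Y) ↔ IsTilting n Y ∧ perpN n Y (G.obj (F.obj Y)) := by
  have h0 := isPartialTilting_map_iff adj e hY
  constructor
  · intro h
    obtain ⟨h1, h2⟩ := h0.1 h.toIsPartialTilting
    refine ⟨⟨h1, fun P hP => ?_⟩, h2⟩
    exact ((h.coresolution _ (adj.map_projective P hP)).map adj'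
      (isAcyclicFor_section adj e hY)).of_iso ((compIsoId adj e adj').app Y)
      ((compIsoId adj e adj').app P)
  · rintro ⟨h, h1⟩
    refine ⟨h0.2 ⟨h.toIsPartialTilting, h1⟩, fun Q hQ => ?_⟩
    obtain ⟨P, hP, ⟨i⟩⟩ := hproj Q hQ
    exact ((h.coresolution P hP).map adj hY).of_iso (Iso.refl _) i

end Tilting

/-! ### Tensoring along a ring homomorphism is left adjoint to restriction -/

section ExtendRestrict

variable {A B : Type u} [Ring A] [Ring B] (f : A →+* B) [Module Aᵐᵒᵖ B] [SMulCommClass B Aᵐᵒᵖ B]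
  (hf : ∀ (a : A) (b : B), MulOpposite.op a • b = b * f a)

/-- A linear map `X ⟶ W` along `f` extends to `B ⊗_A X ⟶ W`. -/
noncomputable def extendHom (hf : ∀ (a : A) (b : B), MulOpposite.op a • b = b * f a) {X : ModuleCat.{u} A}
    {W : ModuleCat.{u} B} (g : X ⟶ (ModuleCat.restrictScalars f).obj W) :
    (tensorFunctor A B B).obj X ⟶ W :=
  ModuleCat.ofHom (Y := W)
    { BTensor.lift (R := A) (M := B) (Y := X)
        (AddMonoidHom.mk' (fun b => AddMonoidHom.mk' (fun x => (b • (g.hom x : W) : W))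
          (fun x y => by rw [map_add]; exact smul_add b (g.hom x : W) (g.hom y : W)))
          (fun b b' => by ext x; exact add_smul b b' (g.hom x : W)))
        (fun b a x => by
          change (MulOpposite.op a • b) • (g.hom x : W) = b • (g.hom (a • x) : W)
          rw [hf, mul_smul, map_smul]
          rfl) with
      map_smul' := fun b z => by
        induction z using BTensor.induction with
        | ht c x => exact mul_smul b c (g.hom x : W)
        | ha z z' hz hz' =>
          simp only [smul_add, ZeroHom.toFun_eq_coe, AddMonoidHom.toZeroHom_coe, map_add,
            RingHom.id_apply] at *
          rw [hz, hz']
          exact (smul_add b (_ : W) (_ : W)).symm }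

/-- The restriction of a linear map on `B ⊗_A X` to `X`. -/
noncomputable def restrictHom (hf : ∀ (a : A) (b : B), MulOpposite.op a • b = b * f a) {X : ModuleCat.{u} A}
    {W : ModuleCat.{u} B} (g : (tensorFunctor A B B).obj X ⟶ W) :
    X ⟶ (ModuleCat.restrictScalars f).obj W :=
  ModuleCat.ofHom (Y := (ModuleCat.restrictScalars f).obj W)
    { toFun := fun x => g.hom (tmul A (1 : B) x)
      map_add' := fun x y => by rw [tmul_add]; exact map_add g.hom _ _
      map_smul' := fun a x => by
        rw [← tmul_balanced, hf, one_mul]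
        refine Eq.trans ?_ (map_smul g.hom (f a) (tmul A (1 : B) x))
        refine congrArg g.hom ?_
        exact (congrArg (tmul A · x) (mul_one (f a))).symm }

/-- `B ⊗_A -` is left adjoint to the restriction of scalars along `f : A → B`. -/
noncomputable def tensorAdjunction : tensorFunctor A B B ⊣ ModuleCat.restrictScalars.{u} f :=
  Adjunction.mkOfHomEquiv
    { homEquiv := fun X W =>
        { toFun := restrictHom f hf
          invFun := extendHom f hf
          left_inv := fun g => by
            ext z
            refine DFunLike.congr_fun (BTensor.hom_ext (f := (extendHom f hf
              (restrictHom f hf g)).hom.toAddMonoidHom) (g := g.hom.toAddMonoidHom)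
              fun b x => ?_) z
            refine (map_smul g.hom b (tmul A (1 : B) x)).symm.trans (congrArg g.hom ?_)
            exact congrArg (tmul A · x) (mul_one b)
          right_inv := fun g => by
            ext x
            exact one_smul B (g.hom x : W) }
      homEquiv_naturality_left_symm := fun {X X' W} g h => by
        ext z
        exact DFunLike.congr_fun (BTensor.hom_ext
          (f := (extendHom f hf (g ≫ h)).hom.toAddMonoidHom)
          (g := ((tensorFunctor A B B).map g ≫ extendHom f hf h).hom.toAddMonoidHom)
          fun b x => rfl) z
      homEquiv_naturality_right := fun {X W W'} g h => rfl }

end ExtendRestrict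

/-! ### Graded projections, the augmentation, and finiteness from nilpotency -/

namespace TensorRing

variable {R : Type u} [Ring R]
variable {N : Type u} [AddCommGroup N] [Module R N] [Module Rᵐᵒᵖ N] [SMulCommClass R Rᵐᵒᵖ N]

theorem mul_def (a b : TensorRing R N) : a * b = mul R N a b := rfl

theorem shift_eq_mul (n : N) (t : TensorRing R N) :
    shift R N n t = shift R N n 1 * t := by
  rw [mul_def, mul_shift, ← mul_def, one_mul]

theorem incl_mul (r : R) (t : TensorRing R N) : incl R N r * t = r • t := mul_of_zero r t

theorem op_smul_def (r : R) (t : TensorRing R N) : MulOpposite.op r • t = t * incl R N r := rfl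

/-- Right scalars act on the last tensor factor while `cons` adds a first one, so the inductive step
commutes with them. -/
theorem of_op_smul (i : ℕ) (r : R) (x : TPow R N i) :
    of R N i (MulOpposite.op r • x) = MulOpposite.op r • of R N i x := by
  induction i with
  | zero => exact (incl R N).map_mul' x r
  | succ i ih =>
    induction x using pow_induction with
    | ht n x =>
      refine (shift_of n i (MulOpposite.op r • x)).symm.trans ?_
      rw [ih, ← shift_of, op_smul_def, op_smul_def, mul_def, mul_def, mul_shift]
    | ha a b iha ihb => rw [smul_add, map_add, map_add, smul_add, iha, ihb]

variable (R N)

/-- The inclusion of `N^i` is right `R`-linear. -/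
def ofRight (i : ℕ) : TPow R N i →ₗ[Rᵐᵒᵖ] TensorRing R N :=
  { of R N i with map_smul' := fun r x => of_op_smul i r.unop x }

open Classical in
/-- The projection onto `N^i`. -/
def proj (i : ℕ) : TensorRing R N →+ TPow R N i :=
  desc R N fun j => if h : j = i then h ▸ AddMonoidHom.id _ else 0

variable {R N}

@[simp] theorem proj_of_self (i : ℕ) (x : TPow R N i) : proj R N i (of R N i x) = x := by
  simp [proj]

theorem proj_of_ne {i j : ℕ} (h : j ≠ i) (x : TPow R N j) : proj R N i (of R N j x) = 0 := by
  simp [proj, h]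

theorem proj_smul (i : ℕ) (r : R) (t : TensorRing R N) : proj R N i (r • t) = r • proj R N i t := by
  refine DFunLike.congr_fun (hom_ext (f := (proj R N i).comp
    (DistribSMul.toAddMonoidHom (TensorRing R N) r)) (g := (DistribSMul.toAddMonoidHom _ r).comp
      (proj R N i)) fun j x => ?_) t
  simp only [AddMonoidHom.comp_apply, DistribSMul.toAddMonoidHom_apply, smul_of]
  by_cases h : j = i
  · subst h; simp
  · simp [proj_of_ne h]

theorem proj_op_smul (i : ℕ) (r : R) (t : TensorRing R N) :
    proj R N i (MulOpposite.op r • t) = MulOpposite.op r • proj R N i t := by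
  refine DFunLike.congr_fun (hom_ext (f := (proj R N i).comp
    (DistribSMul.toAddMonoidHom (TensorRing R N) (MulOpposite.op r)))
    (g := (DistribSMul.toAddMonoidHom _ (MulOpposite.op r)).comp (proj R N i)) fun j x => ?_) t
  simp only [AddMonoidHom.comp_apply, DistribSMul.toAddMonoidHom_apply, ← of_op_smul]
  by_cases h : j = i
  · subst h; simp
  · simp [proj_of_ne h]

variable (R N)

/-- The projection onto `N^i` is right `R`-linear. -/
def projRight (i : ℕ) : TensorRing R N →ₗ[Rᵐᵒᵖ] TPow R N i :=
  { proj R N i with map_smul' := fun r x => proj_op_smul i r.unop x }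

variable {R N}

theorem proj_shift_zero (n : N) (t : TensorRing R N) : proj R N 0 (shift R N n t) = 0 := by
  refine DFunLike.congr_fun (hom_ext (f := (proj R N 0).comp (shift R N n)) (g := 0)
    fun j x => ?_) t
  simp [proj_of_ne]

variable (R N)

/-- The augmentation `T_R(N) → R`. -/
def aug : TensorRing R N →+* R where
  toFun := proj R N 0
  map_one' := proj_of_self 0 (1 : R)
  map_zero' := map_zero _
  map_add' := map_add _
  map_mul' a b := by
    induction a using induction with
    | h0 r =>
      rw [mul_def, mul_of_zero, proj_smul]
      exact congrArg (fun s : R => HMul.hMul (α := R) (β := R) (γ := R) s (proj R N 0 b)) (proj_of_self 0 r).symm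
    | hs n t ih =>
      rw [mul_def, mul_shift, proj_shift_zero, proj_shift_zero]
      exact (zero_mul (M₀ := R) _).symm
    | ha a b iha ihb =>
      rw [add_mul, map_add, map_add, iha, ihb]
      exact (add_mul (R := R) _ _ _).symm

theorem aug_comp_incl : (aug R N).comp (incl R N) = RingHom.id R :=
  RingHom.ext fun r => proj_of_self 0 r

theorem aug_shift (n : N) (t : TensorRing R N) : aug R N (shift R N n t) = 0 := proj_shift_zero n t

variable {R N}

theorem subsingleton_pow {m : ℕ} (hN : IsNilpotentBimodule R N m) {i : ℕ} (hi : m < i) :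
    Subsingleton (TPow R N i) := by
  induction i, hi using Nat.le_induction with
  | base => exact hN
  | succ i hi ih =>
    refine ⟨fun a b => ?_⟩
    have key : ∀ x : TPow R N (i + 1), x = 0 := fun x => by
      induction x using pow_induction with
      | ht n x => rw [Subsingleton.elim x 0]; exact tmul_zero n
      | ha a b iha ihb => rw [iha, ihb, add_zero]
    rw [key a, key b]

/-- Nilpotency makes the decomposition of the identity a fixed finite sum; every splitting of an
induced module below rests on it. -/
theorem sum_of_proj {m : ℕ} (hN : IsNilpotentBimodule R N m) (t : TensorRing R N) :
    ∑ i ∈ Finset.range (m + 1), of R N i (proj R N i t) = t := by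
  have : ∑ i ∈ Finset.range (m + 1), (of R N i).comp (proj R N i) = AddMonoidHom.id _ := by
    refine hom_ext fun j x => ?_
    rw [AddMonoidHom.finsetSum_apply]
    simp only [AddMonoidHom.comp_apply, AddMonoidHom.id_apply]
    by_cases hj : j ∈ Finset.range (m + 1)
    · rw [Finset.sum_eq_single_of_mem j hj fun i _ hi => by rw [proj_of_ne hi.symm, map_zero],
        proj_of_self]
    · have := subsingleton_pow hN (i := j) (by simpa using hj)
      rw [Subsingleton.elim x 0]
      simp
  simpa [AddMonoidHom.finsetSum_apply] using DFunLike.congr_fun this t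

end TensorRing

variable {R : Type u} [Ring R]
variable {N : Type u} [AddCommGroup N] [Module R N] [Module Rᵐᵒᵖ N] [SMulCommClass R Rᵐᵒᵖ N]

namespace TensorRing

/-! ### Nakayama's lemma for the augmentation ideal of a nilpotent tensor ring -/

section Nakayama

variable {W : Type u} [AddCommGroup W] [Module (TensorRing R N) W]

/-- The product of the augmentation ideal of `T_R(N)` with a module. -/
def augSpan (W : Type u) [AddCommGroup W] [Module (TensorRing R N) W] : AddSubgroup W :=
  AddSubgroup.closure {z | ∃ (n : N) (x : W), z = shift R N n 1 • x}

theorem shift_smul_mem_augSpan (n : N) (t : TensorRing R N) (x : W) :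
    shift R N n t • x ∈ augSpan (R := R) (N := N) W := by
  rw [shift_eq_mul, mul_smul]
  exact AddSubgroup.subset_closure ⟨n, t • x, rfl⟩

theorem incl_smul_mem_augSpan (r : R) {x : W} (hx : x ∈ augSpan (R := R) (N := N) W) :
    incl R N r • x ∈ augSpan (R := R) (N := N) W := by
  induction hx using AddSubgroup.closure_induction with
  | mem z hz =>
    obtain ⟨n, x, rfl⟩ := hz
    rw [← mul_smul, incl_mul, ← TensorRing.shift_smul]
    exact shift_smul_mem_augSpan _ _ _
  | zero => rw [smul_zero]; exact zero_mem _
  | add a b _ _ ha hb => rw [smul_add]; exact add_mem ha hb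
  | neg a _ ha => rw [smul_neg]; exact neg_mem ha

/-- Modulo `augSpan`, the tensor ring acts through its augmentation. -/
theorem smul_sub_aug_smul_mem_augSpan (t : TensorRing R N) (x : W) :
    t • x - incl R N (aug R N t) • x ∈ augSpan (R := R) (N := N) W := by
  induction t using induction with
  | h0 r =>
    have : aug R N (of R N 0 r) = r := proj_of_self 0 r
    rw [this]
    exact (sub_self (incl R N r • x)).symm ▸ zero_mem _
  | hs n t ih =>
    rw [aug_shift, map_zero, zero_smul, sub_zero]
    exact shift_smul_mem_augSpan n t x
  | ha a b iha ihb =>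
    have := add_mem iha ihb
    rw [map_add, map_add, add_smul, add_smul]
    convert this using 1
    abel

/-- Iterating W = N·W gives W = N^k·W; for k = m + 1 this kills W. -/
theorem mem_closure_of_augSpan_eq_top (h : augSpan (R := R) (N := N) W = ⊤) (k : ℕ) (x : W) :
    x ∈ AddSubgroup.closure {z : W | ∃ (y : TPow R N k) (x : W), z = of R N k y • x} := by
  induction k generalizing x with
  | zero => exact AddSubgroup.subset_closure ⟨(1 : R), x, (one_smul (TensorRing R N) x).symm⟩
  | succ k ih =>
    have hx : x ∈ augSpan (R := R) (N := N) W := h ▸ AddSubgroup.mem_top x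
    refine (AddSubgroup.closure_le _).2 ?_ hx
    rintro _ ⟨n, x, rfl⟩
    change shift R N n 1 • x ∈ AddSubgroup.closure _
    induction ih x using AddSubgroup.closure_induction with
    | mem z hz =>
      obtain ⟨y, x, rfl⟩ := hz
      rw [← mul_smul, ← shift_eq_mul, shift_of]
      exact AddSubgroup.subset_closure ⟨_, x, rfl⟩
    | zero => rw [smul_zero]; exact zero_mem _
    | add a b _ _ ha hb => rw [smul_add]; exact add_mem ha hb
    | neg a _ ha => rw [smul_neg]; exact neg_mem ha

theorem subsingleton_of_augSpan_eq_top {m : ℕ} (hN : IsNilpotentBimodule R N m)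
    (h : augSpan (R := R) (N := N) W = ⊤) : Subsingleton W := by
  refine ⟨fun a b => ?_⟩
  have key : ∀ x : W, x = 0 := fun x => by
    have := mem_closure_of_augSpan_eq_top h (m + 1) x
    refine (AddSubgroup.mem_bot).1 ((AddSubgroup.closure_le ⊥).2 ?_ this)
    rintro _ ⟨y, x, rfl⟩
    have : y = 0 := hN.elim y 0
    rw [this, map_zero, zero_smul]
    exact zero_mem _
  rw [key a, key b]

end Nakayama

/-! ### The two adjunctions and induced projectives -/

variable (R N)

/-- `R` is a right `T_R(N)`-module along the augmentation. -/
abbrev augRightModule : Module (TensorRing R N)ᵐᵒᵖ R := Module.compHom R (aug R N).op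

attribute [local instance] augRightModule

theorem aug_op_smul (t : TensorRing R N) (r : R) : MulOpposite.op t • r = r * aug R N t := rfl

theorem aug_smulCommClass : SMulCommClass R (TensorRing R N)ᵐᵒᵖ R where
  smul_comm a t b := (mul_assoc a b (aug R N t.unop)).symm

attribute [local instance] aug_smulCommClass

/-- The functor `R ⊗_{T_R(N)} -`. -/
abbrev coinvariantsFunctor : ModuleCat.{u} (TensorRing R N) ⥤ ModuleCat.{u} R :=
  tensorFunctor (TensorRing R N) R R

/-- The induction functor is left adjoint to the restriction along `R → T_R(N)`. -/
noncomputable def inductionAdjunction :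
    inductionFunctor R N ⊣ ModuleCat.restrictScalars.{u} (incl R N) :=
  tensorAdjunction (incl R N) fun _ _ => rfl

/-- `R ⊗_{T_R(N)} -` is left adjoint to the restriction along the augmentation. -/
noncomputable def coinvariantsAdjunction :
    coinvariantsFunctor R N ⊣ ModuleCat.restrictScalars.{u} (aug R N) :=
  tensorAdjunction (aug R N) fun _ _ => rfl

/-- Restriction along the augmentation is a section of restriction along `R → T_R(N)`. -/
noncomputable def augSectionIso :
    ModuleCat.restrictScalars.{u} (aug R N) ⋙ ModuleCat.restrictScalars.{u} (incl R N) ≅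
      𝟭 (ModuleCat.{u} R) :=
  (ModuleCat.restrictScalarsComp' (incl R N) (aug R N) _ rfl).symm ≪≫
    ModuleCat.restrictScalarsId' _ (aug_comp_incl R N)

variable {R N}

instance (Q : ModuleCat.{u} (TensorRing R N)) : Epi ((coinvariantsAdjunction R N).unit.app Q) := by
  rw [ModuleCat.epi_iff_surjective]
  intro z
  change BTensor (TensorRing R N) R Q at z
  induction z using BTensor.induction with
  | ht r x =>
    refine ⟨incl R N r • x, ?_⟩
    refine (tmul_balanced (1 : R) (incl R N r) x).symm.trans (congrArg (tmul _ · x) ?_)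
    rw [aug_op_smul, one_mul]
    exact proj_of_self 0 r
  | ha a b ha hb =>
    obtain ⟨x, rfl⟩ := ha
    obtain ⟨y, rfl⟩ := hb
    exact ⟨x + y, map_add _ x y⟩

/-- The map r ⊗ x ↦ r x from R ⊗_T Q to Q modulo `augSpan` is well defined and sends 1 ⊗ x to the
class of x. -/
theorem mem_augSpan_of_unit_eq_zero {Q : ModuleCat.{u} (TensorRing R N)} (x : Q)
    (hx : ((coinvariantsAdjunction R N).unit.app Q).hom x = 0) :
    x ∈ augSpan (R := R) (N := N) Q := by
  let f : BTensor (TensorRing R N) R Q →+ Q ⧸ augSpan (R := R) (N := N) Q :=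
    BTensor.lift
      (AddMonoidHom.mk' (fun r => AddMonoidHom.mk' (fun x => QuotientAddGroup.mk (incl R N r • x))
        (fun x y => by rw [smul_add]; rfl))
        (fun r s => by ext x; simp [add_smul]))
      (fun r t x => by
        rw [aug_op_smul]
        refine (QuotientAddGroup.eq_iff_sub_mem).2 ?_
        rw [map_mul, mul_smul, ← smul_sub]
        refine incl_smul_mem_augSpan r ?_
        rw [← neg_sub]
        exact neg_mem (smul_sub_aug_smul_mem_augSpan t x))
  have h1 : f (tmul (TensorRing R N) (1 : R) x) = 0 := (congrArg f hx).trans (map_zero f)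
  have h2 : f (tmul (TensorRing R N) (1 : R) x) = QuotientAddGroup.mk x := by
    refine congrArg QuotientAddGroup.mk ?_
    exact (congrArg (· • x) (map_one (incl R N))).trans (one_smul _ x)
  exact (QuotientAddGroup.eq_zero_iff x).1 (h2.symm.trans h1)

/-- The hypothesis, applied to the unit of the cokernel, kills its coinvariants; Nakayama then kills
the cokernel. -/
theorem epi_of_forall_aug {m : ℕ} (hN : IsNilpotentBimodule R N m)
    {A B : ModuleCat.{u} (TensorRing R N)} (g : A ⟶ B)
    (hg : ∀ (L : ModuleCat.{u} R) (φ : B ⟶ (ModuleCat.restrictScalars (aug R N)).obj L),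
      g ≫ φ = 0 → φ = 0) : Epi g := by
  refine Preadditive.epi_of_isZero_cokernel g ?_
  have h : (coinvariantsAdjunction R N).unit.app (cokernel g) = 0 :=
    (cancel_epi (cokernel.π g)).1 ((hg _ _ (by rw [cokernel.condition_assoc, zero_comp])).trans
      comp_zero.symm)
  have := subsingleton_of_augSpan_eq_top (R := R) (N := N) (W := (cokernel g :)) hN
    (eq_top_iff.2 fun x _ => mem_augSpan_of_unit_eq_zero x (by rw [h]; rfl))
  exact ModuleCat.isZero_of_subsingleton _

/-- Over a nilpotent tensor ring, every projective module is induced from a projective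
`R`-module. -/
theorem exists_iso_induction {m : ℕ} (hN : IsNilpotentBimodule R N m)
    (Q : ModuleCat.{u} (TensorRing R N)) (hQ : Projective Q) :
    ∃ P : ModuleCat.{u} R, Projective P ∧ Nonempty ((inductionFunctor R N).obj P ≅ Q) := by
  let P := (coinvariantsFunctor R N).obj Q
  let Z := ModuleCat.restrictScalars.{u} (aug R N)
  have : Z.PreservesEpimorphisms := preservesEpimorphisms_of_preservesColimitsOfShape Z
  have hP : Projective P := (coinvariantsAdjunction R N).map_projective _ hQ
  have hP' : Projective ((inductionFunctor R N).obj P) :=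
    have : (ModuleCat.restrictScalars.{u} (incl R N)).PreservesEpimorphisms :=
      preservesEpimorphisms_of_preservesColimitsOfShape _
    (inductionAdjunction R N).map_projective _ hP
  let p : Q ⟶ Z.obj P := (coinvariantsAdjunction R N).unit.app Q
  let q : ∀ L : ModuleCat.{u} R, (inductionFunctor R N).obj L ⟶ Z.obj L := fun L =>
    ((inductionAdjunction R N).homEquiv L (Z.obj L)).symm ((augSectionIso R N).inv.app L)
  have hq : ∀ L, Epi (q L) := fun L => by
    rw [ModuleCat.epi_iff_surjective]
    exact fun y => ⟨tmul R (1 : TensorRing R N) (y : L), one_smul (TensorRing R N) (y : Z.obj L)⟩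
  -- This identifies `q A` as the universal map from the induced module to modules on which T acts
  -- through the augmentation.
  have hfac : ∀ {A L : ModuleCat.{u} R} (φ : (inductionFunctor R N).obj A ⟶ Z.obj L),
      ∃ φ' : A ⟶ L, φ = q A ≫ Z.map φ' := fun {A L} φ => by
    refine ⟨(inductionAdjunction R N).homEquiv _ _ φ ≫ (augSectionIso R N).hom.app L,
      ((inductionAdjunction R N).homEquiv _ _).injective ?_⟩
    rw [(inductionAdjunction R N).homEquiv_naturality_right, Equiv.apply_symm_apply]
    have := (augSectionIso R N).inv.naturality ((inductionAdjunction R N).homEquiv _ _ φ ≫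
      (augSectionIso R N).hom.app L)
    refine Eq.trans ?_ this
    rw [Functor.id_map, Category.assoc]
    exact ((congrArg (_ ≫ ·) ((augSectionIso R N).hom_inv_id_app L)).trans
      (Category.comp_id _)).symm
  -- Both modules are projective with the same coinvariants P. The lift h is epi by Nakayama, hence
  -- split; its section is epi for the same reason, so h is invertible.
  let h : (inductionFunctor R N).obj P ⟶ Q := Projective.factorThru (q P) p
  have hh : h ≫ p = q P := Projective.factorThru_comp _ _
  have hepi : Epi h := epi_of_forall_aug hN h fun L φ hφ => by
    obtain ⟨φ', rfl⟩ : ∃ φ', p ≫ Z.map φ' = φ :=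
      ⟨((coinvariantsAdjunction R N).homEquiv _ _).symm φ, by
        rw [← Adjunction.homEquiv_unit, Equiv.apply_symm_apply]⟩
    rw [reassoc_of% hh] at hφ
    have : Z.map φ' = 0 := (cancel_epi (q P)).1 (hφ.trans comp_zero.symm)
    rw [this, comp_zero]
  let s : Q ⟶ (inductionFunctor R N).obj P := Projective.factorThru (𝟙 Q) h
  have hs : s ≫ h = 𝟙 Q := Projective.factorThru_comp _ _
  have hepi' : Epi s := epi_of_forall_aug hN s fun L φ hφ => by
    obtain ⟨φ', rfl⟩ := hfac φ
    have h1 : s ≫ q P = p := by rw [← hh, reassoc_of% hs]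
    rw [reassoc_of% h1] at hφ
    have : Z.map φ' = 0 := (cancel_epi p).1 (hφ.trans comp_zero.symm)
    rw [this, comp_zero]
  refine ⟨P, hP, ⟨⟨h, s, ?_, hs⟩⟩⟩
  rw [← cancel_epi s, reassoc_of% hs, Category.comp_id]

end TensorRing

variable {R : Type u} [Ring R]

/-! ### The decomposition of an induced module -/

theorem BTensor.map_map {M M' M'' Y Y' Y'' : Type u} [AddCommGroup M] [AddCommGroup M']
    [AddCommGroup M''] [AddCommGroup Y] [AddCommGroup Y'] [AddCommGroup Y''] [Module Rᵐᵒᵖ M]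
    [Module Rᵐᵒᵖ M'] [Module Rᵐᵒᵖ M''] [Module R Y] [Module R Y'] [Module R Y'']
    (f : M →ₗ[Rᵐᵒᵖ] M') (f' : M' →ₗ[Rᵐᵒᵖ] M'') (g : Y →ₗ[R] Y') (g' : Y' →ₗ[R] Y'')
    (z : BTensor R M Y) : BTensor.map f' g' (BTensor.map f g z) =
      BTensor.map (f'.comp f) (g'.comp g) z :=
  DFunLike.congr_fun (BTensor.hom_ext (f := (BTensor.map f' g').comp (BTensor.map f g))
    (g := BTensor.map (f'.comp f) (g'.comp g)) fun _ _ => rfl) z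

/-- R ⊗_R - is the identity up to isomorphism; this settles the summand i = 0, on which no Tor
hypothesis is imposed. -/
theorem exact_regular_tensor {S : ShortComplex (ModuleCat.{u} R)} (hS : S.Exact)
    (z : BTensor R R S.X₂)
    (hz : BTensor.map (LinearMap.id : R →ₗ[Rᵐᵒᵖ] R) S.g.hom z = 0) :
    ∃ w : BTensor R R S.X₁, BTensor.map (LinearMap.id : R →ₗ[Rᵐᵒᵖ] R) S.f.hom w = z := by
  let e : ∀ X : ModuleCat.{u} R, BTensor R R X →+ X := fun X =>
    BTensor.lift (smulAddHom R X) fun a r x => mul_smul a r x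
  have he : ∀ (X : ModuleCat.{u} R) (z : BTensor R R X), z = tmul R (1 : R) (e X z) := fun X z => by
    induction z using BTensor.induction with
    | ht a x =>
      refine Eq.trans ?_ (tmul_balanced (1 : R) a x)
      exact congrArg (tmul R · x) (one_mul a).symm
    | ha a b ha hb => rw [map_add, tmul_add, ← ha, ← hb]
  have h1 : S.g.hom (e _ z) = 0 := by
    have : e _ (BTensor.map (LinearMap.id : R →ₗ[Rᵐᵒᵖ] R) S.g.hom z) = S.g.hom (e _ z) :=
      DFunLike.congr_fun (BTensor.hom_ext (f := (e _).comp (BTensor.map LinearMap.id S.g.hom))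
        (g := S.g.hom.toAddMonoidHom.comp (e _)) fun a x => (map_smul S.g.hom a x).symm) z
    rw [← this, hz, map_zero]
  obtain ⟨w, hw⟩ := (ShortComplex.moduleCat_exact_iff _).1 hS _ h1
  refine ⟨tmul R (1 : R) w, ?_⟩
  rw [he _ z]
  exact congrArg (tmul R (1 : R)) hw

variable {N : Type u} [AddCommGroup N] [Module R N] [Module Rᵐᵒᵖ N] [SMulCommClass R Rᵐᵒᵖ N]

namespace TensorRing

variable (R N) in
/-- The underlying `R`-module of an induced module. -/
noncomputable abbrev inducedRestriction (Y : ModuleCat.{u} R) : ModuleCat.{u} R :=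
  (ModuleCat.restrictScalars.{u} (incl R N)).obj ((inductionFunctor R N).obj Y)

/-- The inclusion of `N^i ⊗_R Y` in `T_R(N) ⊗_R Y`. -/
noncomputable def powInclusion (i : ℕ) (Y : ModuleCat.{u} R) :
    (powFunctor R N i).obj Y ⟶ inducedRestriction R N Y :=
  ModuleCat.ofHom (Y := inducedRestriction R N Y)
    { BTensor.map (ofRight R N i) (LinearMap.id : Y →ₗ[R] Y) with
      map_smul' := fun r z => by
        change BTensor.map (ofRight R N i) LinearMap.id (r • z) =
          incl R N r • BTensor.map (ofRight R N i) LinearMap.id z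
        induction z using BTensor.induction with
        | ht x y =>
          refine congrArg (tmul R · y) ?_
          exact (smul_of i r x).symm.trans (incl_mul r _).symm
        | ha a b iha ihb => rw [smul_add, map_add, iha, ihb, map_add, smul_add] }

/-- The projection of `T_R(N) ⊗_R Y` onto `N^i ⊗_R Y`. -/
noncomputable def powProjection (i : ℕ) (Y : ModuleCat.{u} R) :
    inducedRestriction R N Y ⟶ (powFunctor R N i).obj Y :=
  ModuleCat.ofHom (X := inducedRestriction R N Y)
    { BTensor.map (projRight R N i) (LinearMap.id : Y →ₗ[R] Y) with
      map_smul' := fun r z => by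
        change BTensor R (TensorRing R N) Y at z
        change BTensor.map (projRight R N i) LinearMap.id (incl R N r • z) =
          r • BTensor.map (projRight R N i) LinearMap.id z
        induction z using BTensor.induction with
        | ht t y =>
          refine congrArg (tmul R · y) ?_
          exact (congrArg (proj R N i) (incl_mul r t)).trans (proj_smul i r t)
        | ha a b iha ihb => rw [smul_add, map_add, iha, ihb, map_add, smul_add] }

/-- `N^i ⊗_R Y` is a direct summand of `T_R(N) ⊗_R Y`. -/
noncomputable def powRetract (i : ℕ) (Y : ModuleCat.{u} R) :
    Retract ((powFunctor R N i).obj Y) (inducedRestriction R N Y) where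
  i := powInclusion i Y
  r := powProjection i Y
  retract := by
    ext z
    exact DFunLike.congr_fun (BTensor.hom_ext (f := (BTensor.map (projRight R N i) LinearMap.id).comp
      (BTensor.map (ofRight R N i) LinearMap.id)) (g := AddMonoidHom.id _)
      fun x (y : Y) => congrArg (tmul R · y) (proj_of_self i x)) z

theorem map_id_eq_sum {m : ℕ} (hN : IsNilpotentBimodule R N m) {Y : Type u} [AddCommGroup Y]
    [Module R Y] (z : BTensor R (TensorRing R N) Y) :
    ∑ i ∈ Finset.range (m + 1), BTensor.map (ofRight R N i) (LinearMap.id : Y →ₗ[R] Y)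
      (BTensor.map (projRight R N i) LinearMap.id z) = z := by
  have : ∑ i ∈ Finset.range (m + 1), (BTensor.map (ofRight R N i) (LinearMap.id : Y →ₗ[R] Y)).comp
      (BTensor.map (projRight R N i) LinearMap.id) = AddMonoidHom.id _ :=
    BTensor.hom_ext fun t y => by
      rw [AddMonoidHom.finsetSum_apply]
      refine Eq.trans ?_ (congrArg (tmul R · y) (sum_of_proj hN t))
      exact (map_sum (AddMonoidHom.mk' (fun t => tmul R t y) fun s t => add_tmul s t y)
        (fun i => of R N i (proj R N i t)) _).symm
  simpa [AddMonoidHom.finsetSum_apply] using DFunLike.congr_fun this z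

theorem sum_powProjection_powInclusion {m : ℕ} (hN : IsNilpotentBimodule R N m)
    (Y : ModuleCat.{u} R) :
    ∑ i ∈ Finset.range (m + 1), powProjection (N := N) i Y ≫ powInclusion i Y =
      𝟙 (inducedRestriction R N Y) := by
  ext z
  rw [ModuleCat.hom_sum, LinearMap.sum_apply]
  exact map_id_eq_sum hN z

/-- `N^0 ⊗_R Y` is `Y`. -/
noncomputable def powZeroIso (Y : ModuleCat.{u} R) : (powFunctor R N 0).obj Y ≅ Y :=
  ((Adjunction.id (C := ModuleCat.{u} R)).leftAdjointUniq
    ((tensorAdjunction (RingHom.id R) fun _ _ => rfl).ofNatIsoRight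
      (ModuleCat.restrictScalarsId' _ rfl))).symm.app Y

/-- Project a cycle to each N^i ⊗ S₂, lift it there, and add up the finitely many lifts. -/
theorem exact_induction {m : ℕ} (hN : IsNilpotentBimodule R N m)
    (S : ShortComplex (ModuleCat.{u} R))
    (h : ∀ i, i ≤ m → ∀ z : BTensor R (TPow R N i) S.X₂,
      BTensor.map LinearMap.id S.g.hom z = 0 → ∃ w, BTensor.map LinearMap.id S.f.hom w = z)
    (w : (inductionFunctor R N).map S.f ≫ (inductionFunctor R N).map S.g = 0) :
    (ShortComplex.mk _ _ w).Exact := by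
  rw [ShortComplex.moduleCat_exact_iff]
  intro z hz
  change BTensor R (TensorRing R N) S.X₂ at z
  change BTensor.map LinearMap.id S.g.hom z = 0 at hz
  have h1 : ∀ i, ∃ w, i ∈ Finset.range (m + 1) → BTensor.map LinearMap.id S.f.hom w =
      BTensor.map (projRight R N i) LinearMap.id z := fun i => by
    by_cases hi : i ∈ Finset.range (m + 1)
    · obtain ⟨w, hw⟩ := h i (by simpa [Nat.lt_succ_iff] using hi)
        (BTensor.map (projRight R N i) LinearMap.id z) (by
          have : BTensor.map (projRight R N i) (LinearMap.id : S.X₃ →ₗ[R] S.X₃)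
            (BTensor.map LinearMap.id S.g.hom z) = 0 := by rw [hz, map_zero]
          rw [BTensor.map_map] at this ⊢
          exact this)
      exact ⟨w, fun _ => hw⟩
    · exact ⟨0, fun h => (hi h).elim⟩
  choose v hv using h1
  refine ⟨(∑ i ∈ Finset.range (m + 1), BTensor.map (ofRight R N i)
    (LinearMap.id : S.X₁ →ₗ[R] S.X₁) (v i) : BTensor R (TensorRing R N) S.X₁), ?_⟩
  change BTensor.map LinearMap.id S.f.hom _ = z
  rw [map_sum]
  refine Eq.trans (Finset.sum_congr rfl fun i hi => ?_) (map_id_eq_sum hN z)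
  rw [← hv i hi, BTensor.map_map, BTensor.map_map]
  rfl

/-- Vanishing Tor says that each N^i ⊗ - with 1 ≤ i ≤ m keeps a projective resolution of Y exact in
degrees 1, …, k; hence so does induction. -/
theorem isAcyclicFor_of_isZero_tor {m : ℕ} (hN : IsNilpotentBimodule R N m) (k : ℕ)
    (Y : ModuleCat.{u} R) (h : ∀ i : ℕ, 1 ≤ i → i ≤ m → ∀ t : ℕ, 1 ≤ t → t ≤ k →
      IsZero ((torFunctor R (TPow R N i) t).obj Y)) :
    IsAcyclicFor (ModuleCat.restrictScalars.{u} (incl R N)) k Y := by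
  have := (inductionAdjunction R N).isLeftAdjoint
  let P := projectiveResolution Y
  refine IsAcyclicFor.of_projectiveResolution (inductionAdjunction R N) P fun s hs => ?_
  refine exact_induction hN (ShortComplex.mk (P.complex.d (s + 1 + 1) (s + 1))
    (P.complex.d (s + 1) s) (by simp)) (fun i hi z hz => ?_) _
  obtain rfl | hi0 := Nat.eq_zero_or_pos i
  · exact exact_regular_tensor (P.exact_succ s) z hz
  · have h1 := (h i hi0 hi (s + 1) (by lia) hs).of_iso
      (P.isoLeftDerivedObj (tensorAb R (TPow R N i)) (s + 1)).symm
    have h2 : HomologicalComplex.ExactAt (((tensorAb R (TPow R N i)).mapHomologicalComplex _).obj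
        P.complex) (s + 1) := (HomologicalComplex.exactAt_iff_isZero_homology _ _).2 h1
    rw [HomologicalComplex.exactAt_iff' _ (s + 1 + 1) (s + 1) s (by simp) (by simp),
      ShortComplex.ab_exact_iff] at h2
    exact h2 z hz

end TensorRing

/-! ### Splitting the conditions on G(F Y) over its summands -/

namespace TensorRing

variable {R : Type u} [Ring R]
variable {N : Type u} [AddCommGroup N] [Module R N] [Module Rᵐᵒᵖ N] [SMulCommClass R Rᵐᵒᵖ N]

theorem classD_inducedRestriction_iff {m : ℕ} (hN : IsNilpotentBimodule R N m)
    {P₁ P₀ : ModuleCat.{u} R} [Projective P₁] (σ : P₁ ⟶ P₀) {Y : ModuleCat.{u} R}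
    (hY : classD σ Y) : classD σ (inducedRestriction R N Y) ↔
      ∀ i : ℕ, 1 ≤ i → i ≤ m → classD σ ((powFunctor R N i).obj Y) := by
  refine ⟨fun h i _ _ => classD_of_retract σ (powRetract i Y) h, fun h =>
    classD_of_sum_eq_id σ _ _ _ (sum_powProjection_powInclusion hN Y) fun i hi => ?_⟩
  -- The summand i = 0 is Y itself, which is covered by `hY`.
  obtain rfl | hi0 := Nat.eq_zero_or_pos i
  · exact classD_of_epi σ (powZeroIso Y).inv hY
  · exact h i hi0 (by simpa [Nat.lt_succ_iff] using hi)

theorem perpN_inducedRestriction_iff {m : ℕ} (hN : IsNilpotentBimodule R N m) {n : ℕ}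
    {X Y : ModuleCat.{u} R} (hY : perpN n X Y) : perpN n X (inducedRestriction R N Y) ↔
      ∀ i : ℕ, 1 ≤ i → i ≤ m → perpN n X ((powFunctor R N i).obj Y) := by
  refine ⟨fun h i _ _ j h₁ h₂ => subsingleton_ext_of_retract_right (powRetract i Y) _ _ (h j h₁ h₂),
    fun h j h₁ h₂ => subsingleton_ext_of_sum_eq_id _ _ _ (sum_powProjection_powInclusion hN Y) _ _
      fun i hi => ?_⟩
  obtain rfl | hi0 := Nat.eq_zero_or_pos i
  · exact subsingleton_ext_of_retract_right (Retract.ofIso (powZeroIso Y)) _ _ (hY j h₁ h₂)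
  · exact h i hi0 (by simpa [Nat.lt_succ_iff] using hi) j h₁ h₂

end TensorRing

end SiltingTensor

/-! ### The theorem, by specializing the adjunction criteria -/

open SiltingTensor in
theorem corollary4p4 {R : Type u} [Ring R]
    (N : Type u) [AddCommGroup N] [Module R N] [Module Rᵐᵒᵖ N] [SMulCommClass R Rᵐᵒᵖ N]
    (m : ℕ) (hN : IsNilpotentBimodule R N m)
    {P₁ P₀ : ModuleCat.{u} R} (σ : P₁ ⟶ P₀) (Y : ModuleCat.{u} R)
    (hσ : IsProjectivePresentation σ Y) :
    ((IsSilting ((inductionFunctor R N).map σ) ((inductionFunctor R N).obj Y) ↔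
        IsSilting σ Y ∧ ∀ i : ℕ, 1 ≤ i → i ≤ m → Gen Y ((powFunctor R N i).obj Y)) ∧
      (IsPartialSilting ((inductionFunctor R N).map σ) ((inductionFunctor R N).obj Y) ↔
        IsPartialSilting σ Y ∧ ∀ i : ℕ, 1 ≤ i → i ≤ m → classD σ ((powFunctor R N i).obj Y))) ∧
    ∀ n : ℕ,
      (∀ i : ℕ, 1 ≤ i → i ≤ m → ∀ t : ℕ, 1 ≤ t → t ≤ n + 1 →
        IsZero ((torFunctor R (TPow R N i) t).obj Y)) →
      (IsTilting n ((inductionFunctor R N).obj Y) ↔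
        IsTilting n Y ∧ ∀ i : ℕ, 1 ≤ i → i ≤ m → perpN n Y ((powFunctor R N i).obj Y)) ∧
      (IsPartialTilting n ((inductionFunctor R N).obj Y) ↔
        IsPartialTilting n Y ∧
          ∀ i : ℕ, 1 ≤ i → i ≤ m → perpN n Y ((powFunctor R N i).obj Y)) := by
  have adj := TensorRing.inductionAdjunction R N
  have adj' := TensorRing.coinvariantsAdjunction R N
  have e := TensorRing.augSectionIso R N
  have : (ModuleCat.restrictScalars.{u} (TensorRing.incl R N)).PreservesEpimorphisms :=
    preservesEpimorphisms_of_preservesColimitsOfShape _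
  have hP₁ := hσ.1
  refine ⟨⟨?_, ?_⟩, fun n hTor => ?_⟩
  -- The counit is epi because restriction of scalars is faithful.
  · have : ∀ X, Epi (adj.counit.app X) := fun X => by
      have := adj.isRightAdjoint
      infer_instance
    rw [isSilting_map_iff adj e adj' hσ]
    refine and_congr_right fun h => ?_
    -- Gen Y is not visibly closed under direct sum decompositions of the identity, but it equals
    -- 𝒟_σ once Y is silting.
    rw [h.gen_eq]
    exact TensorRing.classD_inducedRestriction_iff hN σ (h.gen_eq ▸ Gen.self Y)
  · rw [isPartialSilting_map_iff adj e hσ]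
    exact and_congr_right fun h => TensorRing.classD_inducedRestriction_iff hN σ h.mem
  · have hY := TensorRing.isAcyclicFor_of_isZero_tor hN (n + 1) Y hTor
    -- The summand i = 0 contributes Ext^j(Y, Y), which vanishes as soon as Y is partial tilting.
    have hperp : IsPartialTilting n Y → _ := fun h =>
      TensorRing.perpN_inducedRestriction_iff (X := Y) hN fun j h₁ (_ : j ≤ n) => h.ext_self j h₁
    constructor
    · rw [isTilting_map_iff adj e adj' (TensorRing.exists_iso_induction hN) hY]
      exact and_congr_right fun h => hperp h.toIsPartialTilting
    · rw [isPartialTilting_map_iff adj e hY]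
      exact and_congr_right hperp
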